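/- **Notation.** $\mathcal P(X)$ is the set of Borel probability measures on $X$, and $\mathcal P_c(\mathbb R)$ the set of those on $\mathbb R$ with compact support; $T\mathbb R=\mathbb R\times\mathbb R\ni(x,v)$; $B(0,R)=\,]-R,R[$; $W$ is the 1-Wasserstein distance on $\mathbb R$, with value $+\infty$ between measures of different total mass. A probability vector field (PVF) is a map $V:\mathcal P(\mathbb R)\to\mathcal P(T\mathbb R)$ such that the first marginal of $V[\mu]$ is $\mu$. For $V_1,V_2\in\mathcal P(T\mathbb R)$ with first marginals $\mu_1,\mu_2$, $\mathcal W(V_1,V_2)$ is the infimum of $\int|v-w|\,d\mathcal T(x,v,y,w)$ over the couplings $\mathcal T$ of $V_1,V_2$ whose image under $(x,v,y,w)\mapsto(x,y)$ is an optimal plan for $W(\mu_1,\mu_2)$. Consider the conditions * (H1) there is $C>0$ with $\sup_{(x,v)\in \mathrm{Supp}\,V[\mu]}|v|\le C\,(1+\sup_{x\in \mathrm{Supp}\,\mu}|x|)$ for all $\mu\in\mathcal P_c(\mathbb R)$; * (H3) for every $R>0$ there is $K>0$ with $\mathcal W(V[\mu],V[\nu])\le K\,W(\mu,\nu)$ for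 all $\mu,\nu\in\mathcal P_c(\mathbb R)$ with supports in $B(0,R)$. *Solutions.* A map $\mu:[0,T]\to\mathcal P_c(\mathbb R)$ is a solution of $\dot\mu=V[\mu]$, $\mu(0)=\mu_0$ if it satisfies the initial condition and, for every $f\in C_c^\infty(\mathbb R)$, the integral $I(s)=\int f'(x)\,v\,dV[\mu(s)](x,v)$ exists for a.e. $s\in[0,T]$, $I\in L^1(0,T)$, and $t\mapsto\int f\,d\mu(t)$ is absolutely continuous on $[0,T]$ with derivative $I(t)$ for a.e. $t$. *Lattice approximate solutions (LASs).* For $N\ge1$ let $x_i=i/N^2$ ($|i|\le N^3$) and $v_j=j/N$ ($|j|\le N^2$). Put $\mu^N_0=\sum_i\mu_0([x_i,x_i+N^{-2}[)\,\delta_{x_i}$ and, for $\ell\ge0$ and $0\le s\le 1/N$, $$\mu^N(\ell/N+s)=\sum_{i,j}V[\mu^N_\ell]\big(\{x_i\}\times[v_j,v_j+\tfrac1N[\big)\,\delta_{x_i+s v_j},\qquad \mu^N_{\ell+1}=\mu^N((\ell+1)/N).$$ (If $N$ is so small that mass leaves the grid and $\mu^N_\ell$ is not a probability measure, $V[\mu^N_\ell]$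 is replaced by $0$; for fixed $\mu_0,T$ this does not affect limits as $N\to\infty$.) A limit of LASs on $[0,T]$ is a curve $\mu:[0,T]\to\mathcal P_c(\mathbb R)$ with $\sup_{t\in[0,T]}W(\mu^N(t),\mu(t))\to0$ as $N\to\infty$, possibly along a subsequence. *Lipschitz semigroups.* If $V$ satisfies (H1) with constant $C$, a Lipschitz semigroup on $[0,T]$ is a map $S:[0,T]\times\mathcal P_c(\mathbb R)\to\mathcal P_c(\mathbb R)$ such that $S_0\mu=\mu$; $S_tS_s\mu=S_{t+s}\mu$ if $t,s,t+s\in[0,T]$; $t\mapsto S_t\mu$ is a solution with initial datum $\mu$; and for every $R>0$ there is $C(R)>0$ such that, for $\mu,\nu$ with supports in $B(0,R)$ and $t,s\in[0,T]$: $\mathrm{Supp}(S_t\mu)\subset B(0,e^{Ct}(R+1))$, $W(S_t\mu,S_t\nu)\le e^{C(R)t}W(\mu,\nu)$ and $W(S_t\mu,S_s\mu)\le C(R)|t-s|$. *The median-splitting PVF.* For $\mu\in\mathcal P(\mathbb R)$ let $B(\mu)=\sup\{x:\mu(]-\infty,x])\le\frac12\}$, $\eta(\mu)=\mu(]-\infty,B(\mu)])-\frac12$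 and $\xi(\mu)=\frac12-\mu(]-\infty,B(\mu)[)$; then $\eta(\mu),\xi(\mu)\ge0$ and $\eta(\mu)+\xi(\mu)=\mu(\{B(\mu)\})$. Let $V[\mu]=\mu\otimes\nu_x$, where $\nu_x=\delta_{-1}$ for $x<B(\mu)$, $\nu_x=\delta_1$ for $x>B(\mu)$, and $$\nu_{B(\mu)}=\frac{\eta(\mu)\,\delta_1+\xi(\mu)\,\delta_{-1}}{\mu(\{B(\mu)\})}$$ if $\mu(\{B(\mu)\})>0$ (if $\mu(\{B(\mu)\})=0$ the choice of $\nu_{B(\mu)}$ is irrelevant). **Proposition.** The median-splitting PVF $V$ satisfies (H1) and (H3), and in fact $\mathcal W(V[\mu],V[\nu])=0$ for all $\mu,\nu\in\mathcal P_c(\mathbb R)$. For every $T>0$ there is a map $S:[0,T]\times\mathcal P_c(\mathbb R)\to\mathcal P_c(\mathbb R)$ such that: 1. for every $\mu_0\in\mathcal P_c(\mathbb R)$ the whole sequence of LASs from $\mu_0$ converges on $[0,T]$ to $t\mapsto S_t\mu_0$, and no subsequence of it has another limit; 2. for every constant $C$ as in (H1), $S$ is a Lipschitz semigroup on $[0,T]$,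 and it is the only one whose trajectories are limits of LASs; 3. for every $\mu_0\in\mathcal P_c(\mathbb R)$, $t\in[0,T]$ and Borel set $A$, with $B=B(\mu_0)$, $\mu(t)=S_t\mu_0$ satisfies $$\mu(t)(A)=\mu_0\big((A\cap]-\infty,B-t[)+t\big)+\mu_0\big((A\cap]B+t,+\infty[)-t\big)+\eta(\mu_0)\,\delta_{B+t}(A)+\xi(\mu_0)\,\delta_{B-t}(A);$$ 4. for $\mu_0=\delta_{x_0}$ and $t\in[0,T]$, $S_t\mu_0=\frac12\delta_{x_0+t}+\frac12\delta_{x_0-t}$; 5. for $a<b$, $\mu_0=\frac1{b-a}\chi_{[a,b]}\lambda$ ($\lambda$ the Lebesgue measure) and $t\in[0,T]$, $S_t\mu_0=\frac1{b-a}\chi_{[a-t,\frac{a+b}2-t]}\lambda+\frac1{b-a}\chi_{[\frac{a+b}2+t,b+t]}\lambda$. -/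

import Mathlib

open MeasureTheory ProbabilityTheory Set Filter Topology
open scoped ENNReal ContDiff

noncomputable section

namespace MDE

/-! ### Probability measures with compact support, optimal transport -/

/-- The set `𝒫_c(ℝ)` of Borel probability measures on `ℝ` with compact support. -/
abbrev Pc : Type := {μ : ProbabilityMeasure ℝ // IsCompact (μ : Measure ℝ).support}

/-- The support of an element of `𝒫_c(ℝ)`. -/
def Pc.supp (μ : Pc) : Set ℝ := (μ.1 : Measure ℝ).support

section Transport

variable {X : Type*} [PseudoEMetricSpace X] [MeasurableSpace X]

/-- `τ ∈ P(μ, ν)`: `τ` is a transference plan from `μ` to `ν`. -/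
def IsPlan (τ : Measure (X × X)) (μ ν : Measure X) : Prop :=
  τ.map Prod.fst = μ ∧ τ.map Prod.snd = ν

/-- The transportation cost `J(τ) = ∫ d(x, y) dτ(x, y)`. -/
def cost (τ : Measure (X × X)) : ℝ≥0∞ := ∫⁻ p, edist p.1 p.2 ∂τ

/-- The Wasserstein distance `W(μ, ν) = inf {J(τ) : τ ∈ P(μ, ν)}`
(it is `∞` if `μ` and `ν` have different total masses). -/
def W (μ ν : Measure X) : ℝ≥0∞ := ⨅ (τ : Measure (X × X)) (_ : IsPlan τ μ ν), cost τ

/-- `τ ∈ P^opt(μ, ν)`: `τ` is a plan from `μ` to `ν` of minimal cost. -/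
def IsOptPlan (τ : Measure (X × X)) (μ ν : Measure X) : Prop :=
  IsPlan τ μ ν ∧ ∀ τ' : Measure (X × X), IsPlan τ' μ ν → cost τ ≤ cost τ'

end Transport

/-- The projection `π₁₃ (x, v, y, w) = (x, y)` on the bases. -/
def proj13 (p : (ℝ × ℝ) × (ℝ × ℝ)) : ℝ × ℝ := (p.1.1, p.2.1)

/-- For `V₁, V₂` on `Tℝ = ℝ × ℝ` with base marginals `μ₁, μ₂`, the infimum of `∫ |v - w| dT` over
the plans `T ∈ P(V₁, V₂)` whose projection on the bases is an optimal plan from `μ₁` to `μ₂`. -/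
def fiberW (V₁ V₂ : Measure (ℝ × ℝ)) : ℝ≥0∞ :=
  ⨅ (T : Measure ((ℝ × ℝ) × (ℝ × ℝ))) (_ : IsPlan T V₁ V₂)
    (_ : IsOptPlan (T.map proj13) (V₁.map Prod.fst) (V₂.map Prod.fst)),
    ∫⁻ p, edist p.1.2 p.2.2 ∂T

/-! ### Probability vector fields and measure differential equations -/

/-- A probability vector field on `ℝ`: a map `V : 𝒫(ℝ) → 𝒫(Tℝ)` with `π₁ # V[μ] = μ`. -/
structure PVF where
  /-- the underlying map -/
  toFun : ProbabilityMeasure ℝ → ProbabilityMeasure (ℝ × ℝ)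
  /-- the base marginal of `V[μ]` is `μ` -/
  base : ∀ μ, (toFun μ : Measure (ℝ × ℝ)).map Prod.fst = (μ : Measure ℝ)

/-- `V[μ]`, as a measure. -/
def PVF.meas (V : PVF) (μ : ProbabilityMeasure ℝ) : Measure (ℝ × ℝ) := V.toFun μ

/-- `C` is a constant of support sublinearity of `V`:
`sup_{(x,v) ∈ Supp V[μ]} |v| ≤ C (1 + sup_{x ∈ Supp μ} |x|)` for all `μ ∈ 𝒫_c(ℝ)`. -/
def SupportSublinear (V : PVF) (C : ℝ) : Prop :=
  ∀ μ : Pc, ∀ p ∈ (V.meas μ.1).support, |p.2| ≤ C * (1 + sSup ((fun x : ℝ => |x|) '' μ.supp))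

/-- Condition (H1): `V` is support sublinear. -/
def H1 (V : PVF) : Prop := ∃ C : ℝ, 0 < C ∧ SupportSublinear V C

/-- Condition (H3): for every `R > 0` there is `K > 0` such that
`𝒲(V[μ], V[ν]) ≤ K W(μ, ν)` whenever `Supp μ, Supp ν ⊂ B(0, R)`. -/
def H3 (V : PVF) : Prop :=
  ∀ R : ℝ, 0 < R → ∃ K : ℝ, 0 < K ∧ ∀ μ ν : Pc,
    μ.supp ⊆ Metric.ball 0 R → ν.supp ⊆ Metric.ball 0 R →
      fiberW (V.meas μ.1) (V.meas ν.1) ≤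
        ENNReal.ofReal K * W (μ.1 : Measure ℝ) (ν.1 : Measure ℝ)

/-- `ρ` (only its values on `[0, T]` matter) is a weak solution on `[0, T]` of the Cauchy problem
`ρ' = V[ρ]`, `ρ(0) = μ₀`. -/
def IsSolution (V : PVF) (T : ℝ) (μ₀ : Pc) (ρ : ℝ → Pc) : Prop :=
  ρ 0 = μ₀ ∧ ∀ f : ℝ → ℝ, ContDiff ℝ ∞ f → HasCompactSupport f →
    (∀ᵐ s ∂(volume.restrict (Icc 0 T)),
      Integrable (fun p : ℝ × ℝ => deriv f p.1 * p.2) (V.meas (ρ s).1)) ∧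
    IntegrableOn (fun s => ∫ p, deriv f p.1 * p.2 ∂(V.meas (ρ s).1)) (Icc 0 T) volume ∧
    AbsolutelyContinuousOnInterval (fun t => ∫ x, f x ∂((ρ t).1 : Measure ℝ)) 0 T ∧
    ∀ᵐ t ∂(volume.restrict (Icc 0 T)),
      HasDerivAt (fun t => ∫ x, f x ∂((ρ t).1 : Measure ℝ))
        (∫ p, deriv f p.1 * p.2 ∂(V.meas (ρ t).1)) t

/-- `S : [0, T] × 𝒫_c(ℝ) → 𝒫_c(ℝ)` (only the values `S t μ` with `t ∈ [0, T]` matter) is a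
Lipschitz semigroup for `μ' = V[μ]`, where `C` is a constant of support sublinearity of `V`. -/
structure IsLipschitzSemigroup (V : PVF) (C T : ℝ) (S : ℝ → Pc → Pc) : Prop where
  zero : ∀ μ, S 0 μ = μ
  add : ∀ μ, ∀ t ∈ Icc 0 T, ∀ s ∈ Icc 0 T, t + s ∈ Icc 0 T → S t (S s μ) = S (t + s) μ
  solution : ∀ μ, IsSolution V T μ (fun t => S t μ)
  bounds : ∀ R : ℝ, 0 < R → ∃ CR : ℝ, 0 < CR ∧ ∀ μ ν : Pc,
    μ.supp ⊆ Metric.ball 0 R → ν.supp ⊆ Metric.ball 0 R → ∀ t ∈ Icc 0 T, ∀ s ∈ Icc 0 T,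
      (S t μ).supp ⊆ Metric.ball 0 (Real.exp (C * t) * (R + 1)) ∧
      W ((S t μ).1 : Measure ℝ) ((S t ν).1 : Measure ℝ) ≤
        ENNReal.ofReal (Real.exp (CR * t)) * W (μ.1 : Measure ℝ) (ν.1 : Measure ℝ) ∧
      W ((S t μ).1 : Measure ℝ) ((S s μ).1 : Measure ℝ) ≤ ENNReal.ofReal (CR * |t - s|)

/-! ### Lattice approximate solutions -/

/-- The space grid points `x_i = i / N²`; the grid in `[-N, N]` is `-N³ ≤ i ≤ N³`. -/
def gridX (N : ℕ) (i : ℤ) : ℝ := (i : ℝ) / (N : ℝ) ^ 2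

/-- The velocity grid points `v_j = j / N`; the grid in `[-N, N]` is `-N² ≤ j ≤ N²`. -/
def gridV (N : ℕ) (j : ℤ) : ℝ := (j : ℝ) / (N : ℝ)

/-- The indices of the space grid. -/
def idxX (N : ℕ) : Finset ℤ := Finset.Icc (-(N : ℤ) ^ 3) ((N : ℤ) ^ 3)

/-- The indices of the velocity grid. -/
def idxV (N : ℕ) : Finset ℤ := Finset.Icc (-(N : ℤ) ^ 2) ((N : ℤ) ^ 2)

/-- `𝒜^x_N(μ) = ∑_i μ(x_i + [0, 1/N²[) δ_{x_i}`. -/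
def discX (N : ℕ) (μ : Measure ℝ) : Measure ℝ :=
  ∑ i ∈ idxX N, μ (Ico (gridX N i) (gridX N i + 1 / (N : ℝ) ^ 2)) • Measure.dirac (gridX N i)

/-- `m^v_{ij}(Λ) = Λ({(x_i, v) : v ∈ v_j + [0, 1/N[})`. -/
def massV (N : ℕ) (Λ : Measure (ℝ × ℝ)) (i j : ℤ) : ℝ≥0∞ :=
  Λ ({gridX N i} ×ˢ Ico (gridV N j) (gridV N j + 1 / (N : ℝ)))

/-- `∑_{ij} m^v_{ij}(Λ) δ_{x_i + s v_j}`. -/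
def advance (N : ℕ) (Λ : Measure (ℝ × ℝ)) (s : ℝ) : Measure ℝ :=
  ∑ i ∈ idxX N, ∑ j ∈ idxV N, massV N Λ i j • Measure.dirac (gridX N i + s * gridV N j)

open Classical in
/-- `V[μ]` for a measure `μ` that is a probability measure, and `0` otherwise. (The grid being
bounded, a lattice approximate solution can lose mass when `N` is small with respect to the
support of the initial datum and to the time; no mass is lost for `N` large.) -/
def PVF.ext (V : PVF) (μ : Measure ℝ) : Measure (ℝ × ℝ) :=
  if h : IsProbabilityMeasure μ then V.meas ⟨μ, h⟩ else 0

/-- The lattice approximate solution at the times `ℓ / N`. -/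
def lasStep (V : PVF) (N : ℕ) (μ₀ : Measure ℝ) : ℕ → Measure ℝ
  | 0 => discX N μ₀
  | ℓ + 1 => advance N (V.ext (lasStep V N μ₀ ℓ)) (1 / (N : ℝ))

/-- The lattice approximate solution `μ^N(t)`, `t ≥ 0`: with `ℓ = ⌊t N⌋`,
`μ^N(t) = ∑_{ij} m^v_{ij}(V[μ^N_ℓ]) δ_{x_i + (t - ℓ/N) v_j}`. -/
def las (V : PVF) (N : ℕ) (μ₀ : Measure ℝ) (t : ℝ) : Measure ℝ :=
  advance N (V.ext (lasStep V N μ₀ ⌊t * (N : ℝ)⌋₊)) (t - (⌊t * (N : ℝ)⌋₊ : ℝ) / (N : ℝ))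

/-- The lattice approximate solutions `μ^{φ(k)}` from `μ₀` converge to `ρ` as `k → ∞`, for the
Wasserstein distance and uniformly on `[0, T]`. -/
def LASTendsto (V : PVF) (T : ℝ) (μ₀ : Pc) (φ : ℕ → ℕ) (ρ : ℝ → Pc) : Prop :=
  Tendsto (fun k => ⨆ t ∈ Icc (0 : ℝ) T,
    W (las V (φ k) (μ₀.1 : Measure ℝ) t) ((ρ t).1 : Measure ℝ)) atTop (𝓝 0)

/-! ### The median-splitting probability vector field -/

/-- `B(μ) = sup {x : μ(]-∞, x]) ≤ 1/2}`. -/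
def med (μ : Measure ℝ) : ℝ := sSup {x : ℝ | μ (Iic x) ≤ 1 / 2}

/-- `η = μ(]-∞, B(μ)]) - 1/2`, the part of the mass at `B(μ)` that moves to the right. -/
def massR (μ : Measure ℝ) : ℝ≥0∞ := μ (Iic (med μ)) - 1 / 2

/-- `1/2 - μ(]-∞, B(μ)[)`, the part of the mass at `B(μ)` that moves to the left. -/
def massL (μ : Measure ℝ) : ℝ≥0∞ := 1 / 2 - μ (Iio (med μ))

theorem medSet_nonempty (μ : Measure ℝ) [IsProbabilityMeasure μ] :
    {x : ℝ | μ (Iic x) ≤ 1 / 2}.Nonempty := by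
  have hm : Antitone fun n : ℕ => Iic (-(n : ℝ)) := by
    intro m n hmn
    apply Iic_subset_Iic.2
    have : (m : ℝ) ≤ n := by exact_mod_cast hmn
    linarith
  have h := tendsto_measure_iInter_atTop (μ := μ)
    (fun n : ℕ => (measurableSet_Iic (a := -(n : ℝ))).nullMeasurableSet) hm
    ⟨0, measure_ne_top _ _⟩
  have he : ⋂ n : ℕ, Iic (-(n : ℝ)) = ∅ := by
    ext x
    simp only [mem_iInter, mem_Iic, mem_empty_iff_false, iff_false, not_forall]
    obtain ⟨n, hn⟩ := exists_nat_gt (-x)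
    exact ⟨n, by linarith⟩
  rw [he, measure_empty] at h
  obtain ⟨n, hn⟩ := (h.eventually (gt_mem_nhds (show (0 : ℝ≥0∞) < 1 / 2 by simp))).exists
  exact ⟨-(n : ℝ), le_of_lt hn⟩

theorem medSet_bddAbove (μ : Measure ℝ) [IsProbabilityMeasure μ] :
    BddAbove {x : ℝ | μ (Iic x) ≤ 1 / 2} := by
  have h := tendsto_measure_Iic_atTop μ
  rw [measure_univ] at h
  have h2 : (1 / 2 : ℝ≥0∞) < 1 := by
    rw [one_div]; exact ENNReal.inv_lt_one.2 (by norm_num)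
  obtain ⟨M, hM⟩ := (h.eventually (lt_mem_nhds h2)).exists
  refine ⟨M, fun x hx => ?_⟩
  by_contra! hlt
  exact absurd ((measure_mono (Iic_subset_Iic.2 hlt.le)).trans hx) (not_le.2 hM)

theorem measure_Iio_med_le (μ : Measure ℝ) [IsProbabilityMeasure μ] :
    μ (Iio (med μ)) ≤ 1 / 2 := by
  have hU : Iio (med μ) = ⋃ n : ℕ, Iic (med μ - 1 / ((n : ℝ) + 1)) := by
    ext x
    simp only [mem_Iio, mem_iUnion, mem_Iic]
    refine ⟨fun h => ?_, fun ⟨n, h⟩ => ?_⟩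
    · obtain ⟨n, hn⟩ := exists_nat_one_div_lt (sub_pos.2 h)
      exact ⟨n, by linarith⟩
    · have : (0 : ℝ) < 1 / ((n : ℝ) + 1) := by positivity
      linarith
  have hm : Monotone fun n : ℕ => Iic (med μ - 1 / ((n : ℝ) + 1)) := by
    intro m n hmn
    apply Iic_subset_Iic.2
    have := Nat.one_div_le_one_div (α := ℝ) hmn
    linarith
  rw [hU, hm.measure_iUnion]
  refine iSup_le fun n => ?_
  have hlt : med μ - 1 / ((n : ℝ) + 1) < med μ := by
    have : (0 : ℝ) < 1 / ((n : ℝ) + 1) := by positivity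
    linarith
  obtain ⟨y, hy, hxy⟩ := exists_lt_of_lt_csSup (medSet_nonempty μ) hlt
  exact (measure_mono (Iic_subset_Iic.2 hxy.le)).trans hy

theorem le_measure_Iic_med (μ : Measure ℝ) [IsProbabilityMeasure μ] :
    1 / 2 ≤ μ (Iic (med μ)) := by
  have hI : Iic (med μ) = ⋂ n : ℕ, Iic (med μ + 1 / ((n : ℝ) + 1)) := by
    ext x
    simp only [mem_Iic, mem_iInter]
    refine ⟨fun h n => ?_, fun h => ?_⟩
    · have : (0 : ℝ) < 1 / ((n : ℝ) + 1) := by positivity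
      linarith
    · by_contra! hx
      obtain ⟨n, hn⟩ := exists_nat_one_div_lt (sub_pos.2 hx)
      have := h n
      linarith
  have hm : Antitone fun n : ℕ => Iic (med μ + 1 / ((n : ℝ) + 1)) := by
    intro m n hmn
    apply Iic_subset_Iic.2
    have := Nat.one_div_le_one_div (α := ℝ) hmn
    linarith
  rw [hI, hm.measure_iInter (fun n => measurableSet_Iic.nullMeasurableSet)
    ⟨0, measure_ne_top _ _⟩]
  refine le_iInf fun n => ?_
  by_contra! h
  have := le_csSup (medSet_bddAbove μ) (mem_ofPred_eq ▸ h.le : med μ + 1 / ((n : ℝ) + 1) ∈ _)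
  have h2 : (0 : ℝ) < 1 / ((n : ℝ) + 1) := by positivity
  change med μ + 1 / ((n : ℝ) + 1) ≤ med μ at this
  linarith

theorem massR_add_massL (μ : Measure ℝ) [IsProbabilityMeasure μ] :
    massR μ + massL μ = μ {med μ} := by
  have h : μ (Iic (med μ)) = μ (Iio (med μ)) + μ {med μ} := by
    rw [← measure_union (by simp) (measurableSet_singleton _), Iio_union_right]
  have h1 := measure_Iio_med_le μ
  have h2 := le_measure_Iic_med μ
  have hne : μ (Iio (med μ)) ≠ ⊤ := measure_ne_top _ _
  rw [massR, massL, tsub_add_tsub_cancel h2 h1, h, ENNReal.add_sub_cancel_left hne]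

open Classical in
/-- The fibre of the vector field at `B(μ)`: the probability measure
`(η δ₁ + (1/2 - μ(]-∞, B(μ)[)) δ₋₁) / μ({B(μ)})`. If `B(μ)` is not an atom of `μ`, its fibre is
irrelevant, and is taken to be `δ₁`. -/
def medFiber (μ : Measure ℝ) : Measure ℝ :=
  if μ {med μ} = 0 then Measure.dirac 1
  else (μ {med μ})⁻¹ • (massR μ • Measure.dirac 1 + massL μ • Measure.dirac (-1))

instance (μ : Measure ℝ) [IsProbabilityMeasure μ] : IsProbabilityMeasure (medFiber μ) := by
  unfold medFiber
  split_ifs with h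
  · infer_instance
  · refine ⟨?_⟩
    simp only [Measure.smul_apply, Measure.add_apply, measure_univ, smul_eq_mul, mul_one]
    rw [massR_add_massL, ENNReal.inv_mul_cancel h (measure_ne_top _ _)]

/-- The fibres `ν_x`: `δ₋₁` if `x < B(μ)`, `δ₁` if `x > B(μ)`, and `medFiber μ` if
`x = B(μ)`. -/
def medKernel (μ : Measure ℝ) : Kernel ℝ ℝ where
  toFun x :=
    if x < med μ then Measure.dirac (-1) else if med μ < x then Measure.dirac 1 else medFiber μ
  measurable' :=
    Measurable.ite measurableSet_Iio measurable_const
      (Measurable.ite measurableSet_Ioi measurable_const measurable_const)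

instance (μ : Measure ℝ) [IsProbabilityMeasure μ] : IsMarkovKernel (medKernel μ) := by
  refine ⟨fun x => ?_⟩
  change IsProbabilityMeasure
    (if x < med μ then Measure.dirac (-1) else if med μ < x then Measure.dirac 1 else medFiber μ)
  split_ifs <;> infer_instance

/-- The median-splitting vector field `V[μ] = μ ⊗ ν_x`. -/
def medianPVF : PVF where
  toFun μ := ⟨(μ : Measure ℝ) ⊗ₘ medKernel (μ : Measure ℝ), inferInstance⟩
  base μ := Measure.fst_compProd (μ : Measure ℝ) (medKernel (μ : Measure ℝ))

end MDE

end

open MDE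

noncomputable section

namespace MDE

/-! ### Splitting a probability measure into its lower and upper halves -/

/-! Write `μ = α + β` with `α`, `β` of mass 1/2, carried by `]-∞, b]` and `[b, ∞[`. Such a splitting
is unique even when the median is not (`IsSplit.lowerHalf_eq`, `IsSplit.upperHalf_eq`), and `V[μ]`
gives velocity -1 to `α` and +1 to `β`. Moving `α` left and `β` right by `t ≥ 0` gives a splitting
again, so every particle keeps its velocity forever. The candidate flow `flowMeas` is therefore a
semigroup, and along it the weak equation reduces to differentiating `∫ f(x + tv) dV[μ]` in `t`.

In quantile coordinates `u ∈ ]0, 1[` the velocity is -1 for `u ≤ 1/2` and +1 otherwise, whatever `μ`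
is. Coupling two measures through the same `u` is optimal on the line (`isOptPlan_monotonePlan`) and
matches velocities exactly, whence `fiberW_medianPVF`; the same coupling shows that the flow does
not increase `W` (`W_flowMeas_le`).

The scheme commits no error after the initial rounding: ±1 are velocity nodes, and a time step `1/N`
moves a particle by exactly `N` space cells. For `N` large the lattice approximate solution is the
exact flow of the rounded datum (`las_medianPVF`), hence within `1/N²` of the true flow, uniformly
in time. Since `W` separates measures, no other limit exists. -/

/-- The lower half of `μ`: the mass to the left of the median, together with the part of the
atom at the median that moves to the left. -/
def lowerHalf (μ : Measure ℝ) : Measure ℝ :=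
  μ.restrict (Iio (med μ)) + massL μ • Measure.dirac (med μ)

/-- The upper half of `μ`. -/
def upperHalf (μ : Measure ℝ) : Measure ℝ :=
  μ.restrict (Ioi (med μ)) + massR μ • Measure.dirac (med μ)

/-- `α` and `β` have mass `1/2` and are carried by `]-∞, b]` and `[b, ∞[`. -/
structure IsSplit (α β : Measure ℝ) (b : ℝ) : Prop where
  univ_left : α univ = 1 / 2
  univ_right : β univ = 1 / 2
  left : α (Ioi b) = 0
  right : β (Iio b) = 0

/-! ### Cutting a measure on the line at a point. -/

theorem measure_Iic_eq_add_singleton (μ : Measure ℝ) (b : ℝ) :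
    μ (Iic b) = μ (Iio b) + μ {b} := by
  rw [← measure_union (by simp) (measurableSet_singleton _), Iio_union_right]

theorem eq_restrict_Iio_add_dirac_add_restrict_Ioi (μ : Measure ℝ) (b : ℝ) :
    μ = μ.restrict (Iio b) + μ {b} • Measure.dirac b + μ.restrict (Ioi b) := by
  conv_lhs => rw [← Measure.restrict_add_restrict_compl (μ := μ) (measurableSet_Iic (a := b))]
  rw [compl_Iic, ← Iio_union_right, Measure.restrict_union (by simp) (measurableSet_singleton b),
    Measure.restrict_singleton]

theorem lintegral_eq_Iio_add_singleton_add_Ioi (μ : Measure ℝ) (b : ℝ) {f : ℝ → ℝ≥0∞}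
    (hf : Measurable f) :
    ∫⁻ x, f x ∂μ = ∫⁻ x in Iio b, f x ∂μ + μ {b} * f b + ∫⁻ x in Ioi b, f x ∂μ := by
  have h := congrArg (fun ν => ∫⁻ x, f x ∂ν) (eq_restrict_Iio_add_dirac_add_restrict_Ioi μ b)
  simpa [lintegral_add_measure, lintegral_dirac' _ hf] using h

theorem eq_restrict_Iio_add_dirac {α : Measure ℝ} {b : ℝ} (h : α (Ioi b) = 0) :
    α = α.restrict (Iio b) + α {b} • Measure.dirac b := by
  conv_lhs => rw [eq_restrict_Iio_add_dirac_add_restrict_Ioi α b,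
    Measure.restrict_eq_zero.2 h, add_zero]

theorem eq_restrict_Ioi_add_dirac {β : Measure ℝ} {b : ℝ} (h : β (Iio b) = 0) :
    β = β.restrict (Ioi b) + β {b} • Measure.dirac b := by
  conv_lhs => rw [eq_restrict_Iio_add_dirac_add_restrict_Ioi β b,
    Measure.restrict_eq_zero.2 h, zero_add, add_comm]

theorem lowerHalf_add_upperHalf (μ : Measure ℝ) [IsProbabilityMeasure μ] :
    lowerHalf μ + upperHalf μ = μ := by
  conv_rhs =>
    rw [eq_restrict_Iio_add_dirac_add_restrict_Ioi μ (med μ), ← massR_add_massL, add_smul]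
  rw [lowerHalf, upperHalf]
  abel

theorem isSplit_halves (μ : Measure ℝ) [IsProbabilityMeasure μ] :
    IsSplit (lowerHalf μ) (upperHalf μ) (med μ) := by
  have hl : lowerHalf μ univ = 1 / 2 := by
    simp only [lowerHalf, Measure.add_apply, Measure.restrict_apply_univ, Measure.smul_apply,
      measure_univ, smul_eq_mul, mul_one, massL]
    exact add_tsub_cancel_of_le (measure_Iio_med_le μ)
  refine ⟨hl, ?_, ?_, ?_⟩
  · have h : lowerHalf μ univ + upperHalf μ univ = 1 / 2 + 1 / 2 := by
      rw [← Measure.add_apply, lowerHalf_add_upperHalf, measure_univ, ENNReal.add_halves]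
    rw [hl] at h
    exact (ENNReal.add_right_inj (by simp)).1 h
  · have h : Ioi (med μ) ∩ Iio (med μ) = ∅ := by
      ext x; simp only [mem_inter_iff, mem_Ioi, mem_Iio, mem_empty_iff_false]; grind
    simp [lowerHalf, Measure.restrict_apply, h]
  · have h : Iio (med μ) ∩ Ioi (med μ) = ∅ := by
      ext x; simp only [mem_inter_iff, mem_Ioi, mem_Iio, mem_empty_iff_false]; grind
    simp [upperHalf, Measure.restrict_apply, h]

namespace IsSplit

variable {α β : Measure ℝ} {b : ℝ}

theorem isFiniteMeasure_left (h : IsSplit α β b) : IsFiniteMeasure α :=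
  ⟨by rw [h.univ_left]; simp⟩

theorem isProbabilityMeasure (h : IsSplit α β b) : IsProbabilityMeasure (α + β) :=
  ⟨by rw [Measure.add_apply, h.univ_left, h.univ_right, ENNReal.add_halves]⟩

theorem left_Iic (h : IsSplit α β b) {x : ℝ} (hx : b ≤ x) : α (Iic x) = 1 / 2 := by
  rw [← h.univ_left]
  refine measure_congr (eventuallyEq_univ.2 ?_)
  rw [mem_ae_iff, compl_Iic]
  exact measure_mono_null (Ioi_subset_Ioi hx) h.left

theorem right_Iic (h : IsSplit α β b) {x : ℝ} (hx : x < b) : β (Iic x) = 0 :=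
  measure_mono_null (Iic_subset_Iio.2 hx) h.right

/-- Up to a level below `b` only `α` contributes, so the mass there is at most 1/2. Equality can
fail: the medians may fill an interval, of which `med` is the right end. -/
theorem le_med (h : IsSplit α β b) : b ≤ med (α + β) := by
  have := h.isProbabilityMeasure
  refine le_of_forall_lt fun x hx => ?_
  obtain ⟨y, hxy, hyb⟩ := exists_between hx
  refine hxy.trans_le (le_csSup (medSet_bddAbove _) ?_)
  change (α + β) (Iic y) ≤ 1 / 2
  rw [Measure.add_apply, h.right_Iic hyb, add_zero, ← h.univ_left]
  exact measure_mono (subset_univ _)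

/-- A splitting may be taken with respect to the median. -/
theorem at_med (h : IsSplit α β b) : IsSplit α β (med (α + β)) := by
  have := h.isProbabilityMeasure
  refine ⟨h.univ_left, h.univ_right, measure_mono_null (Ioi_subset_Ioi h.le_med) h.left, ?_⟩
  have hU : Iio (med (α + β)) = ⋃ n : ℕ, Iic (med (α + β) - 1 / ((n : ℝ) + 1)) := by
    ext x
    simp only [mem_Iio, mem_iUnion, mem_Iic]
    refine ⟨fun h => ?_, fun ⟨n, h⟩ => ?_⟩
    · obtain ⟨n, hn⟩ := exists_nat_one_div_lt (sub_pos.2 h)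
      exact ⟨n, by linarith⟩
    · have : (0 : ℝ) < 1 / ((n : ℝ) + 1) := by positivity
      linarith
  rw [hU, measure_iUnion_null_iff]
  intro n
  have hlt : med (α + β) - 1 / ((n : ℝ) + 1) < med (α + β) := by
    have : (0 : ℝ) < 1 / ((n : ℝ) + 1) := by positivity
    linarith
  obtain ⟨y, hy, hxy⟩ := exists_lt_of_lt_csSup (medSet_nonempty (α + β)) hlt
  refine measure_mono_null (Iic_subset_Iic.2 hxy.le) ?_
  rcases lt_or_ge y b with hyb | hyb
  · exact h.right_Iic hyb
  -- Here `α` alone already accounts for the mass 1/2 allowed up to `y`, so nothing is left for `β`.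
  · change (α + β) (Iic y) ≤ 1 / 2 at hy
    rw [Measure.add_apply, h.left_Iic hyb] at hy
    refine le_zero_iff.1 ((ENNReal.add_le_add_iff_left (a := 1 / 2) (by simp)).1 ?_)
    rwa [add_zero]

/-- Left of the median only `α` has mass, and `massL` is exactly the atom of `α` at the median. With
`upperHalf_eq`, this makes any convenient splitting usable in place of the one given by `med`. -/
theorem lowerHalf_eq (h : IsSplit α β b) : lowerHalf (α + β) = α := by
  have hm := h.at_med
  have := h.isFiniteMeasure_left
  have hα : (α + β) (Iio (med (α + β))) = α (Iio (med (α + β))) := by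
    rw [Measure.add_apply, hm.right, add_zero]
  have h1 := hm.left_Iic le_rfl
  rw [measure_Iic_eq_add_singleton] at h1
  conv_rhs => rw [eq_restrict_Iio_add_dirac hm.left]
  rw [lowerHalf, massL, hα, ← h1, ENNReal.add_sub_cancel_left (measure_ne_top _ _),
    Measure.restrict_add, Measure.restrict_eq_zero.2 hm.right, add_zero]

theorem upperHalf_eq (h : IsSplit α β b) : upperHalf (α + β) = β := by
  have hm := h.at_med
  have h1 : massR (α + β) = β {med (α + β)} := by
    rw [massR, Measure.add_apply, hm.left_Iic le_rfl, ENNReal.add_sub_cancel_left (by simp),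
      measure_Iic_eq_add_singleton, hm.right, zero_add]
  conv_rhs => rw [eq_restrict_Ioi_add_dirac hm.right]
  rw [upperHalf, h1, Measure.restrict_add, Measure.restrict_eq_zero.2 hm.left, zero_add]

/-- Moving the two halves apart yields a splitting. -/
theorem map_sub_add (h : IsSplit α β b) {t : ℝ} (ht : 0 ≤ t) :
    IsSplit (α.map (fun x => x - t)) (β.map (fun x => x + t)) b := by
  refine ⟨?_, ?_, ?_, ?_⟩
  · rw [Measure.map_apply (by fun_prop) .univ, preimage_univ, h.univ_left]
  · rw [Measure.map_apply (by fun_prop) .univ, preimage_univ, h.univ_right]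
  · rw [Measure.map_apply (by fun_prop) measurableSet_Ioi]
    refine measure_mono_null (fun x hx => ?_) h.left
    simp only [mem_preimage, mem_Ioi] at hx ⊢
    linarith
  · rw [Measure.map_apply (by fun_prop) measurableSet_Iio]
    refine measure_mono_null (fun x hx => ?_) h.right
    simp only [mem_preimage, mem_Iio] at hx ⊢
    linarith

end IsSplit

/-! ### The median-splitting vector field in terms of the two halves -/

/-- The mass of the atom at the median cancels the normalisation of `medFiber`, leaving `massR` and
`massL` as weights of the two velocities. -/
theorem medianPVF_meas_eq_halves (μ : ProbabilityMeasure ℝ) :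
    medianPVF.meas μ =
      (lowerHalf (μ : Measure ℝ)).map (fun x => (x, (-1 : ℝ))) +
        (upperHalf (μ : Measure ℝ)).map (fun x => (x, (1 : ℝ))) := by
  obtain ⟨μ, hμ⟩ := μ
  change μ ⊗ₘ medKernel μ = (lowerHalf μ).map _ + (upperHalf μ).map _
  ext E hE
  have hκ : Measurable fun x => medKernel μ x (Prod.mk x ⁻¹' E) :=
    Kernel.measurable_kernel_prodMk_left hE
  have h1 : ∫⁻ x in Iio (med μ), medKernel μ x (Prod.mk x ⁻¹' E) ∂μ =
      μ.restrict (Iio (med μ)) ((fun x => (x, (-1 : ℝ))) ⁻¹' E) := by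
    rw [← lintegral_indicator_one (hE.preimage (by fun_prop))]
    refine setLIntegral_congr_fun measurableSet_Iio fun x hx => ?_
    change (if x < med μ then Measure.dirac (-1) else if med μ < x then Measure.dirac 1
      else medFiber μ) _ = _
    rw [if_pos (mem_Iio.1 hx), Measure.dirac_apply' _ (hE.preimage (by fun_prop))]
    rfl
  have h2 : ∫⁻ x in Ioi (med μ), medKernel μ x (Prod.mk x ⁻¹' E) ∂μ =
      μ.restrict (Ioi (med μ)) ((fun x => (x, (1 : ℝ))) ⁻¹' E) := by
    rw [← lintegral_indicator_one (hE.preimage (by fun_prop))]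
    refine setLIntegral_congr_fun measurableSet_Ioi fun x hx => ?_
    change (if x < med μ then Measure.dirac (-1) else if med μ < x then Measure.dirac 1
      else medFiber μ) _ = _
    rw [if_neg (not_lt.2 (le_of_lt hx)), if_pos (mem_Ioi.1 hx),
      Measure.dirac_apply' _ (hE.preimage (by fun_prop))]
    rfl
  have h3 : μ {med μ} * medKernel μ (med μ) (Prod.mk (med μ) ⁻¹' E) =
      massL μ * Measure.dirac (med μ) ((fun x => (x, (-1 : ℝ))) ⁻¹' E) +
      massR μ * Measure.dirac (med μ) ((fun x => (x, (1 : ℝ))) ⁻¹' E) := by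
    have hk : medKernel μ (med μ) = medFiber μ := by
      change (if med μ < med μ then Measure.dirac (-1) else if med μ < med μ then Measure.dirac 1
        else medFiber μ) = _
      simp
    rw [hk, medFiber]
    have hs := massR_add_massL μ
    split_ifs with h0
    -- Without an atom both parts vanish, because they add up to it; the default fibre then has
    -- weight zero.
    · rw [h0] at hs
      rw [(add_eq_zero.1 hs).1, (add_eq_zero.1 hs).2, h0]
      simp
    · simp only [Measure.smul_apply, Measure.add_apply, smul_eq_mul]
      rw [← mul_assoc, ENNReal.mul_inv_cancel h0 (measure_ne_top _ _), one_mul, add_comm,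
        Measure.dirac_apply' _ (hE.preimage (by fun_prop)),
        Measure.dirac_apply' _ (hE.preimage (by fun_prop)),
        Measure.dirac_apply' _ (hE.preimage (by fun_prop)),
        Measure.dirac_apply' _ (hE.preimage (by fun_prop))]
      rfl
  rw [Measure.compProd_apply hE]
  rw [lintegral_eq_Iio_add_singleton_add_Ioi μ (med μ) hκ,
    h1, h2, h3, Measure.add_apply, Measure.map_apply (by fun_prop) hE,
    Measure.map_apply (by fun_prop) hE, lowerHalf, upperHalf]
  simp only [Measure.smul_apply, Measure.add_apply, smul_eq_mul]
  ring

theorem medianPVF_meas_eq_of_isSplit {α β : Measure ℝ} {b : ℝ} (h : IsSplit α β b)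
    (μ : ProbabilityMeasure ℝ) (hμ : (μ : Measure ℝ) = α + β) :
    medianPVF.meas μ = α.map (fun x => (x, (-1 : ℝ))) + β.map (fun x => (x, (1 : ℝ))) := by
  rw [medianPVF_meas_eq_halves, hμ, h.lowerHalf_eq, h.upperHalf_eq]

/-! ### The flow that moves the two halves apart -/

/-- The measure obtained by moving the lower half of `μ` to the left and its upper half to the
right, by the distance `t`. -/
def flowMeas (μ : Measure ℝ) (t : ℝ) : Measure ℝ :=
  (lowerHalf μ).map (fun x => x - t) + (upperHalf μ).map (fun x => x + t)

theorem IsSplit.flowMeas_eq {α β : Measure ℝ} {b : ℝ} (h : IsSplit α β b) (t : ℝ) :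
    flowMeas (α + β) t = α.map (fun x => x - t) + β.map (fun x => x + t) := by
  rw [flowMeas, h.lowerHalf_eq, h.upperHalf_eq]

theorem flowMeas_apply (μ : Measure ℝ) (t : ℝ) {A : Set ℝ} (hA : MeasurableSet A) :
    flowMeas μ t A =
      μ ((fun x => x + t) '' (A ∩ Iio (med μ - t))) + μ ((fun x => x - t) '' (A ∩ Ioi (med μ + t))) +
        massR μ * Measure.dirac (med μ + t) A + massL μ * Measure.dirac (med μ - t) A := by
  have h1 : (fun x => x + t) '' (A ∩ Iio (med μ - t)) = (fun x => x - t) ⁻¹' A ∩ Iio (med μ) := by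
    ext x
    simp only [mem_image, mem_inter_iff, mem_Iio, mem_preimage]
    exact ⟨by rintro ⟨y, ⟨hy, hb⟩, rfl⟩; exact ⟨by simpa using hy, by linarith⟩,
      fun h => ⟨x - t, ⟨h.1, by linarith [h.2]⟩, by ring⟩⟩
  have h2 : (fun x => x - t) '' (A ∩ Ioi (med μ + t)) = (fun x => x + t) ⁻¹' A ∩ Ioi (med μ) := by
    ext x
    simp only [mem_image, mem_inter_iff, mem_Ioi, mem_preimage]
    exact ⟨by rintro ⟨y, ⟨hy, hb⟩, rfl⟩; exact ⟨by simpa using hy, by linarith⟩,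
      fun h => ⟨x + t, ⟨h.1, by linarith [h.2]⟩, by ring⟩⟩
  have hA1 : MeasurableSet ((fun x => x - t) ⁻¹' A) := hA.preimage (by fun_prop)
  have hA2 : MeasurableSet ((fun x => x + t) ⁻¹' A) := hA.preimage (by fun_prop)
  have d1 : Measure.dirac (med μ) ((fun x => x - t) ⁻¹' A) = Measure.dirac (med μ - t) A := by
    rw [Measure.dirac_apply' _ hA1, Measure.dirac_apply' _ hA]; rfl
  have d2 : Measure.dirac (med μ) ((fun x => x + t) ⁻¹' A) = Measure.dirac (med μ + t) A := by
    rw [Measure.dirac_apply' _ hA2, Measure.dirac_apply' _ hA]; rfl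
  rw [flowMeas, Measure.add_apply, Measure.map_apply (by fun_prop) hA,
    Measure.map_apply (by fun_prop) hA, lowerHalf, upperHalf, h1, h2]
  simp only [Measure.add_apply, Measure.smul_apply, smul_eq_mul, Measure.restrict_apply hA1,
    Measure.restrict_apply hA2, d1, d2]
  ac_rfl

section Flow

variable (μ : Measure ℝ) [IsProbabilityMeasure μ]

instance isProbabilityMeasure_flowMeas (t : ℝ) : IsProbabilityMeasure (flowMeas μ t) := by
  refine ⟨?_⟩
  rw [flowMeas, Measure.add_apply, Measure.map_apply (by fun_prop) .univ,
    Measure.map_apply (by fun_prop) .univ, preimage_univ, preimage_univ, ← Measure.add_apply,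
    lowerHalf_add_upperHalf, measure_univ]

theorem flowMeas_zero : flowMeas μ 0 = μ := by
  simp only [flowMeas, sub_zero, add_zero, Measure.map_id', lowerHalf_add_upperHalf]

/-- After a time `s ≥ 0` the halves of the moved measure are the moved halves, so the translations
compose. -/
theorem flowMeas_flowMeas {s : ℝ} (hs : 0 ≤ s) (t : ℝ) :
    flowMeas (flowMeas μ s) t = flowMeas μ (t + s) := by
  conv_lhs => rw [flowMeas.eq_1 μ s, ((isSplit_halves μ).map_sub_add hs).flowMeas_eq,
    Measure.map_map (by fun_prop) (by fun_prop), Measure.map_map (by fun_prop) (by fun_prop)]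
  rw [flowMeas]
  congr 2 <;> (ext x; simp only [Function.comp]; ring)

end Flow

/-! ### The flow from a Dirac mass and from a uniform measure. -/

theorem flowMeas_dirac (x₀ t : ℝ) :
    flowMeas (Measure.dirac x₀) t =
      (1 / 2 : ℝ≥0∞) • Measure.dirac (x₀ + t) + (1 / 2 : ℝ≥0∞) • Measure.dirac (x₀ - t) := by
  have h : IsSplit ((1 / 2 : ℝ≥0∞) • Measure.dirac x₀) ((1 / 2 : ℝ≥0∞) • Measure.dirac x₀) x₀ :=
    ⟨by simp, by simp, by simp, by simp⟩
  have e : Measure.dirac x₀ =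
      (1 / 2 : ℝ≥0∞) • Measure.dirac x₀ + (1 / 2 : ℝ≥0∞) • Measure.dirac x₀ := by
    rw [← add_smul, ENNReal.add_halves, one_smul]
  rw [e, h.flowMeas_eq, Measure.map_smul, Measure.map_smul, Measure.map_dirac' (by fun_prop),
    Measure.map_dirac' (by fun_prop), add_comm]

theorem flowMeas_uniform {a b : ℝ} (hab : a < b) (t : ℝ) :
    flowMeas ((ENNReal.ofReal (b - a))⁻¹ • volume.restrict (Icc a b)) t =
      (ENNReal.ofReal (b - a))⁻¹ • volume.restrict (Icc (a - t) ((a + b) / 2 - t)) +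
        (ENNReal.ofReal (b - a))⁻¹ • volume.restrict (Icc ((a + b) / 2 + t) (b + t)) := by
  have hpos : ENNReal.ofReal (b - a) ≠ 0 := by simpa using hab
  have hhalf : (ENNReal.ofReal (b - a))⁻¹ * ENNReal.ofReal ((b - a) / 2) = 1 / 2 := by
    rw [ENNReal.ofReal_div_of_pos (by norm_num), ← mul_div_assoc,
      ENNReal.inv_mul_cancel hpos (by simp)]
    simp
  have h : IsSplit ((ENNReal.ofReal (b - a))⁻¹ • volume.restrict (Icc a ((a + b) / 2)))
      ((ENNReal.ofReal (b - a))⁻¹ • volume.restrict (Icc ((a + b) / 2) b)) ((a + b) / 2) := by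
    refine ⟨?_, ?_, ?_, ?_⟩
    · rw [Measure.smul_apply, Measure.restrict_apply_univ, Real.volume_Icc, smul_eq_mul, ← hhalf]
      ring_nf
    · rw [Measure.smul_apply, Measure.restrict_apply_univ, Real.volume_Icc, smul_eq_mul, ← hhalf]
      ring_nf
    · rw [Measure.smul_apply, Measure.restrict_apply measurableSet_Ioi]
      have : Ioi ((a + b) / 2) ∩ Icc a ((a + b) / 2) = ∅ := by
        ext x; simp only [mem_inter_iff, mem_Ioi, mem_Icc, mem_empty_iff_false]; grind
      simp [this]
    · rw [Measure.smul_apply, Measure.restrict_apply measurableSet_Iio]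
      have : Iio ((a + b) / 2) ∩ Icc ((a + b) / 2) b = ∅ := by
        ext x; simp only [mem_inter_iff, mem_Iio, mem_Icc, mem_empty_iff_false]; grind
      simp [this]
  have e : volume.restrict (Icc a b) =
      volume.restrict (Icc a ((a + b) / 2)) + volume.restrict (Icc ((a + b) / 2) b) := by
    -- Dropping the common endpoint, which is Lebesgue-null, makes the two intervals disjoint.
    rw [← Measure.restrict_congr_set (Ioc_ae_eq_Icc (a := (a + b) / 2) (b := b)),
      ← Measure.restrict_union _ measurableSet_Ioc, Icc_union_Ioc_eq_Icc] <;>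
    first
    | linarith
    | exact disjoint_left.2 fun x hx hx' => not_lt.2 hx.2 hx'.1
  have m1 := (measurePreserving_sub_right volume t).restrict_preimage
    (measurableSet_Icc (a := a - t) (b := (a + b) / 2 - t))
  have m2 := (measurePreserving_add_right volume t).restrict_preimage
    (measurableSet_Icc (a := (a + b) / 2 + t) (b := b + t))
  rw [preimage_sub_const_Icc, sub_add_cancel, sub_add_cancel] at m1
  rw [preimage_add_const_Icc, add_sub_cancel_right, add_sub_cancel_right] at m2
  rw [e, smul_add, h.flowMeas_eq, Measure.map_smul, Measure.map_smul, m1.map_eq, m2.map_eq]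

/-! ### Supports -/

theorem support_subset_iff_ae {X : Type*} [TopologicalSpace X] [HereditarilyLindelofSpace X]
    [MeasurableSpace X] {μ : Measure X} {K : Set X} (hK : IsClosed K) :
    μ.support ⊆ K ↔ ∀ᵐ x ∂μ, x ∈ K :=
  ⟨fun h => mem_of_superset Measure.support_mem_ae h, Measure.support_subset_of_isClosed hK⟩

theorem flowMeas_support_subset (μ : Measure ℝ) [IsProbabilityMeasure μ] {R : ℝ}
    (h : μ.support ⊆ Metric.closedBall 0 R) (t : ℝ) :
    (flowMeas μ t).support ⊆ Metric.closedBall 0 (R + |t|) := by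
  rw [support_subset_iff_ae Metric.isClosed_closedBall] at h ⊢
  rw [← lowerHalf_add_upperHalf μ, ae_add_measure_iff] at h
  have hm : MeasurableSet {x : ℝ | x ∈ Metric.closedBall 0 (R + |t|)} :=
    Metric.isClosed_closedBall.measurableSet
  rw [flowMeas, ae_add_measure_iff, ae_map_iff (by fun_prop) hm, ae_map_iff (by fun_prop) hm]
  simp only [mem_closedBall_zero_iff, Real.norm_eq_abs] at h ⊢
  exact ⟨h.1.mono fun x hx => (abs_sub x t).trans (by linarith),
    h.2.mono fun x hx => (abs_add_le x t).trans (by linarith)⟩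

theorem Pc.exists_supp_subset (μ : Pc) : ∃ R : ℝ, 0 < R ∧ μ.supp ⊆ Metric.closedBall 0 R := by
  obtain ⟨R, hR⟩ := μ.2.isBounded.subset_closedBall (0 : ℝ)
  exact ⟨max R 1, by positivity, hR.trans (Metric.closedBall_subset_closedBall (le_max_left _ _))⟩

/-- The semigroup of the median-splitting vector field. -/
def medianFlow (t : ℝ) (μ : Pc) : Pc :=
  ⟨⟨flowMeas (μ.1 : Measure ℝ) t, inferInstance⟩, by
    obtain ⟨R, -, hR⟩ := μ.exists_supp_subset
    exact (isCompact_closedBall (0 : ℝ) (R + |t|)).of_isClosed_subset Measure.isClosed_support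
      (flowMeas_support_subset _ hR t)⟩

theorem coe_medianFlow (t : ℝ) (μ : Pc) :
    ((medianFlow t μ).1 : Measure ℝ) = flowMeas (μ.1 : Measure ℝ) t := rfl

theorem Pc.ext_coe {μ ν : Pc} (h : (μ.1 : Measure ℝ) = ν.1) : μ = ν :=
  Subtype.ext (Subtype.ext h)

/-! ### The vector field along the flow -/

theorem ae_medianPVF_meas (μ : ProbabilityMeasure ℝ) :
    ∀ᵐ p ∂(medianPVF.meas μ), p.2 = -1 ∨ p.2 = 1 := by
  have hm : MeasurableSet {p : ℝ × ℝ | p.2 = -1 ∨ p.2 = 1} :=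
    (measurableSet_eq_fun measurable_snd measurable_const).union
      (measurableSet_eq_fun measurable_snd measurable_const)
  rw [medianPVF_meas_eq_halves, ae_add_measure_iff, ae_map_iff (by fun_prop) hm,
    ae_map_iff (by fun_prop) hm]
  simp

theorem ae_abs_snd_le_one (μ : ProbabilityMeasure ℝ) : ∀ᵐ p ∂(medianPVF.meas μ), |p.2| ≤ 1 := by
  filter_upwards [ae_medianPVF_meas μ] with p hp
  rcases hp with h | h <;> simp [h]

theorem flowMeas_eq_map (μ : ProbabilityMeasure ℝ) (t : ℝ) :
    flowMeas (μ : Measure ℝ) t = (medianPVF.meas μ).map (fun p => p.1 + t * p.2) := by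
  rw [medianPVF_meas_eq_halves, Measure.map_add _ _ (by fun_prop),
    Measure.map_map (by fun_prop) (by fun_prop),
    Measure.map_map (by fun_prop) (by fun_prop), flowMeas]
  congr 2 <;> (ext x; simp [sub_eq_add_neg])

/-- Particles travel freely: the halves never cross, so each keeps the velocity it had at time 0. -/
theorem medianPVF_meas_flowMeas (μ ν : ProbabilityMeasure ℝ) {t : ℝ} (ht : 0 ≤ t)
    (hν : (ν : Measure ℝ) = flowMeas (μ : Measure ℝ) t) :
    medianPVF.meas ν = (medianPVF.meas μ).map (fun p => (p.1 + t * p.2, p.2)) := by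
  rw [medianPVF_meas_eq_of_isSplit ((isSplit_halves (μ : Measure ℝ)).map_sub_add ht) ν hν,
    medianPVF_meas_eq_halves, Measure.map_add _ _ (by fun_prop),
    Measure.map_map (by fun_prop) (by fun_prop),
    Measure.map_map (by fun_prop) (by fun_prop), Measure.map_map (by fun_prop) (by fun_prop),
    Measure.map_map (by fun_prop) (by fun_prop)]
  congr 2 <;> (ext x <;> simp [sub_eq_add_neg])

instance (V : PVF) (μ : ProbabilityMeasure ℝ) : IsProbabilityMeasure (V.meas μ) :=
  inferInstanceAs (IsProbabilityMeasure (V.toFun μ : Measure (ℝ × ℝ)))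

/-! ### Support sublinearity -/

theorem supportSublinear_one : SupportSublinear medianPVF 1 := by
  intro μ p hp
  have hc : IsClosed {p : ℝ × ℝ | |p.2| ≤ 1} := isClosed_le (by fun_prop) continuous_const
  have h := (support_subset_iff_ae hc).2 (ae_abs_snd_le_one μ.1) hp
  have h0 : 0 ≤ sSup ((fun x : ℝ => |x|) '' μ.supp) := by
    refine Real.sSup_nonneg ?_
    rintro _ ⟨x, -, rfl⟩
    exact abs_nonneg x
  have : |p.2| ≤ 1 := h
  linarith

theorem support_dirac_subset (x : ℝ) : (Measure.dirac x).support ⊆ {x} :=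
  (support_subset_iff_ae isClosed_singleton).2
    ((ae_dirac_iff (p := fun y => y ∈ ({x} : Set ℝ)) (measurableSet_singleton x)).2 rfl)

/-- Test on the Dirac mass at 0, where velocity 1 is in the support and `sup |x| = 0`. This makes
the growth rate in the semigroup bound sufficient for every admissible `C`. -/
theorem one_le_of_supportSublinear {C : ℝ} (h : SupportSublinear medianPVF C) : 1 ≤ C := by
  let δ : Pc := ⟨⟨Measure.dirac 0, inferInstance⟩,
    isCompact_singleton.of_isClosed_subset Measure.isClosed_support (support_dirac_subset 0)⟩
  have hs : IsSplit ((1 / 2 : ℝ≥0∞) • Measure.dirac (0 : ℝ)) ((1 / 2 : ℝ≥0∞) • Measure.dirac 0) 0 :=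
    ⟨by simp, by simp, by simp, by simp⟩
  have hV := medianPVF_meas_eq_of_isSplit hs δ.1 (by
    change Measure.dirac (0 : ℝ) = _
    rw [← add_smul, ENNReal.add_halves, one_smul])
  have hmem : ((0 : ℝ), (1 : ℝ)) ∈ (medianPVF.meas δ.1).support := by
    rw [hV, Measure.mem_support_iff_forall]
    intro U hU
    refine lt_of_lt_of_le ?_ (measure_mono (singleton_subset_iff.2 (mem_of_mem_nhds hU)))
    rw [Measure.map_smul, Measure.map_smul, Measure.map_dirac' (by fun_prop),
      Measure.map_dirac' (by fun_prop)]
    simp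
  have h1 := h δ _ hmem
  have h2 : sSup ((fun x : ℝ => |x|) '' δ.supp) = 0 := by
    have h3 : ∀ y ∈ (fun x : ℝ => |x|) '' δ.supp, y = 0 := by
      rintro _ ⟨x, hx, rfl⟩
      simp [show x = 0 from support_dirac_subset 0 hx]
    exact le_antisymm (Real.sSup_nonpos fun y hy => (h3 y hy).le)
      (Real.sSup_nonneg fun y hy => (h3 y hy).ge)
  simpa [h2] using h1

/-! ### The flow solves the equation -/

theorem integral_flowMeas (μ : ProbabilityMeasure ℝ) (t : ℝ) {f : ℝ → ℝ} (hf : Continuous f) :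
    ∫ x, f x ∂(flowMeas (μ : Measure ℝ) t) = ∫ p, f (p.1 + t * p.2) ∂(medianPVF.meas μ) := by
  rw [flowMeas_eq_map, integral_map (by fun_prop) hf.aestronglyMeasurable]

/-- All the time dependence is in `f(x + tv)`, integrated against the fixed measure `V[μ]`;
dominated differentiation applies because `f'` is bounded and `|v| ≤ 1`. -/
theorem isSolution_medianFlow (T : ℝ) (μ : Pc) :
    IsSolution medianPVF T μ (fun t => medianFlow t μ) := by
  refine ⟨Pc.ext_coe (flowMeas_zero _), fun f hf hfc => ?_⟩
  have hf' : Continuous (deriv f) := hf.continuous_deriv (by simp)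
  obtain ⟨M, hM⟩ := hfc.deriv.exists_bound_of_continuous hf'
  obtain ⟨M₀, hM₀⟩ := hfc.exists_bound_of_continuous hf.continuous
  have hM0 : 0 ≤ M := (norm_nonneg _).trans (hM 0)
  have hb : ∀ t : ℝ, ∀ᵐ p ∂(medianPVF.meas μ.1), ‖deriv f (p.1 + t * p.2) * p.2‖ ≤ M := by
    intro t
    filter_upwards [ae_abs_snd_le_one μ.1] with p hp
    rw [norm_mul]
    exact (mul_le_mul (hM _) hp (abs_nonneg _) hM0).trans (by simp)
  have hder : ∀ t : ℝ, HasDerivAt (fun t => ∫ p, f (p.1 + t * p.2) ∂(medianPVF.meas μ.1))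
      (∫ p, deriv f (p.1 + t * p.2) * p.2 ∂(medianPVF.meas μ.1)) t := by
    intro t
    refine (hasDerivAt_integral_of_dominated_loc_of_deriv_le (bound := fun _ => M)
      (F := fun t (p : ℝ × ℝ) => f (p.1 + t * p.2))
      (F' := fun t p => deriv f (p.1 + t * p.2) * p.2) univ_mem ?_ ?_ ?_ ?_
      (integrable_const _) ?_).2
    · exact .of_forall fun t => (hf.continuous.comp (by fun_prop)).aestronglyMeasurable
    · exact Integrable.of_bound (hf.continuous.comp (by fun_prop)).aestronglyMeasurable M₀
        (.of_forall fun p => hM₀ _)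
    · exact ((hf'.comp (by fun_prop)).mul continuous_snd).aestronglyMeasurable
    · filter_upwards [ae_abs_snd_le_one μ.1] with p hp t _
      rw [norm_mul]
      exact (mul_le_mul (hM _) hp (abs_nonneg _) hM0).trans (by simp)
    · refine .of_forall fun p t _ => ?_
      have h1 := ((hf.differentiable (by simp)) (p.1 + t * p.2)).hasDerivAt
      have h2 : HasDerivAt (fun t : ℝ => p.1 + t * p.2) p.2 t := by
        simpa using ((hasDerivAt_id t).mul_const p.2).const_add p.1
      exact h1.comp t h2
  -- The derivative above exists for all real `t`, but it is identified with the term of the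
  -- equation only for `t ≥ 0`, where the splitting persists.
  have hI : ∀ t : ℝ, 0 ≤ t → ∫ p, deriv f p.1 * p.2 ∂(medianPVF.meas (medianFlow t μ).1) =
      ∫ p, deriv f (p.1 + t * p.2) * p.2 ∂(medianPVF.meas μ.1) := by
    intro t ht
    have hc : Continuous fun p : ℝ × ℝ => deriv f p.1 * p.2 :=
      (hf'.comp continuous_fst).mul continuous_snd
    rw [medianPVF_meas_flowMeas μ.1 (medianFlow t μ).1 ht rfl, integral_map (by fun_prop)
      hc.aestronglyMeasurable]
  have hE : (fun t => ∫ x, f x ∂((medianFlow t μ).1 : Measure ℝ)) =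
      fun t => ∫ p, f (p.1 + t * p.2) ∂(medianPVF.meas μ.1) :=
    funext fun t => integral_flowMeas μ.1 t hf.continuous
  simp only [hE]
  have hnn : ∀ t : ℝ, ‖∫ p, deriv f (p.1 + t * p.2) * p.2 ∂(medianPVF.meas μ.1)‖ ≤ M := fun t => by
    simpa using norm_integral_le_of_norm_le_const (hb t)
  refine ⟨?_, ?_, ?_, ?_⟩
  · refine .of_forall fun s => ?_
    refine Integrable.of_bound ((hf'.comp continuous_fst).mul
      continuous_snd).aestronglyMeasurable M ?_
    filter_upwards [ae_abs_snd_le_one (medianFlow s μ).1] with p hp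
    rw [norm_mul]
    exact (mul_le_mul (hM _) hp (abs_nonneg _) hM0).trans (by simp)
  · have hc : Continuous fun t : ℝ => ∫ p, deriv f (p.1 + t * p.2) * p.2 ∂(medianPVF.meas μ.1) := by
      refine continuous_of_dominated (bound := fun _ => M) (fun t => ?_) hb (integrable_const _) ?_
      · exact ((hf'.comp (by fun_prop)).mul continuous_snd).aestronglyMeasurable
      · exact .of_forall fun p => (hf'.comp (by fun_prop)).mul continuous_const
    exact (hc.integrableOn_Icc).congr_fun (fun t ht => (hI t ht.1).symm) measurableSet_Icc
  · have hL : LipschitzWith M.toNNReal fun t => ∫ p, f (p.1 + t * p.2) ∂(medianPVF.meas μ.1) := by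
      refine lipschitzWith_of_nnnorm_deriv_le (fun t => (hder t).differentiableAt) fun t => ?_
      rw [(hder t).deriv, ← NNReal.coe_le_coe, coe_nnnorm, Real.coe_toNNReal _ hM0]
      exact hnn t
    exact hL.lipschitzOnWith.absolutelyContinuousOnInterval
  · refine (ae_restrict_iff' measurableSet_Icc).2 (.of_forall fun t ht => ?_)
    rw [hI t ht.1]
    exact hder t

/-! ### Transport on the line -/

/-- The pairs that the level `z` separates. -/
def separated (z : ℝ) : Set (ℝ × ℝ) := {p | (p.1 ≤ z ∧ z < p.2) ∨ (p.2 ≤ z ∧ z < p.1)}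

theorem measurableSet_separated_uncurry :
    MeasurableSet {q : (ℝ × ℝ) × ℝ | q.1 ∈ separated q.2} := by
  have h1 : Measurable fun q : (ℝ × ℝ) × ℝ => q.1.1 := by fun_prop
  have h2 : Measurable fun q : (ℝ × ℝ) × ℝ => q.1.2 := by fun_prop
  have h3 : Measurable fun q : (ℝ × ℝ) × ℝ => q.2 := by fun_prop
  exact ((measurableSet_le h1 h3).inter (measurableSet_lt h3 h2)).union
    ((measurableSet_le h2 h3).inter (measurableSet_lt h3 h1))

theorem volume_setOf_mem_separated (p : ℝ × ℝ) :
    volume {z : ℝ | p ∈ separated z} = edist p.1 p.2 := by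
  obtain ⟨x, y⟩ := p
  have : {z : ℝ | (x, y) ∈ separated z} = Ico (min x y) (max x y) := by
    ext z
    simp only [separated, mem_ofPred_eq, mem_Ico, min_le_iff, lt_max_iff]
    grind
  rw [this, Real.volume_Ico, max_sub_min_eq_abs, edist_dist, Real.dist_eq, abs_sub_comm]

/-- Fubini: the distance of two points is the length of the set of levels that separate them. -/
theorem cost_eq_lintegral_separated (τ : Measure (ℝ × ℝ)) [SFinite τ] :
    cost τ = ∫⁻ z, τ (separated z) := by
  have h1 := Measure.prod_apply (μ := τ) (ν := volume) measurableSet_separated_uncurry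
  have h2 := Measure.prod_apply_symm (μ := τ) (ν := volume) measurableSet_separated_uncurry
  rw [h1] at h2
  rw [cost]
  refine Eq.trans (lintegral_congr fun p => ?_) h2
  exact (volume_setOf_mem_separated p).symm

theorem isFiniteMeasure_of_isPlan {X : Type*} [MeasurableSpace X] {τ : Measure (X × X)}
    {μ ν : Measure X} [IsFiniteMeasure μ] (h : IsPlan τ μ ν) : IsFiniteMeasure τ := by
  refine ⟨?_⟩
  have : τ univ = μ univ := by
    rw [← h.1, Measure.map_apply measurable_fst .univ, preimage_univ]
  rw [this]
  exact measure_lt_top _ _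

/-- If one marginal has more mass below `z` than the other, the plan must carry the excess across
`z`. -/
theorem edist_cdf_le_measure_separated {τ : Measure (ℝ × ℝ)} {μ ν : Measure ℝ}
    [IsProbabilityMeasure μ] [IsProbabilityMeasure ν] (h : IsPlan τ μ ν) (z : ℝ) :
    edist (cdf μ z) (cdf ν z) ≤ τ (separated z) := by
  have := isFiniteMeasure_of_isPlan h
  have h1 : cdf μ z = τ.real {p | p.1 ≤ z} := by
    rw [cdf_eq_real, ← h.1, map_measureReal_apply measurable_fst measurableSet_Iic]; rfl
  have h2 : cdf ν z = τ.real {p | p.2 ≤ z} := by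
    rw [cdf_eq_real, ← h.2, map_measureReal_apply measurable_snd measurableSet_Iic]; rfl
  rw [edist_dist, Real.dist_eq, ENNReal.ofReal_le_iff_le_toReal (measure_ne_top _ _), h1, h2]
  change _ ≤ τ.real (separated z)
  rw [abs_sub_le_iff]
  constructor
  · rw [sub_le_iff_le_add]
    refine (measureReal_mono fun p hp => ?_).trans (measureReal_union_le _ _)
    simp only [separated, mem_ofPred_eq, mem_union] at hp ⊢
    grind
  · rw [sub_le_iff_le_add]
    refine (measureReal_mono fun p hp => ?_).trans (measureReal_union_le _ _)
    simp only [separated, mem_ofPred_eq, mem_union] at hp ⊢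
    grind

theorem lintegral_edist_cdf_le_cost {τ : Measure (ℝ × ℝ)} {μ ν : Measure ℝ}
    [IsProbabilityMeasure μ] [IsProbabilityMeasure ν] (h : IsPlan τ μ ν) :
    ∫⁻ z, edist (cdf μ z) (cdf ν z) ≤ cost τ := by
  have := isFiniteMeasure_of_isPlan h
  rw [cost_eq_lintegral_separated]
  exact lintegral_mono fun z => edist_cdf_le_measure_separated h z

/-! ### Quantile functions -/

open Classical in
/-- The quantile function of `μ` on `]0, 1[` (and `0` outside). -/
def quantile (μ : Measure ℝ) (u : ℝ) : ℝ :=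
  if u ∈ Ioo (0 : ℝ) 1 then sInf {x | u ≤ cdf μ x} else 0

/-- The Lebesgue measure on `]0, 1[`. -/
def unitVol : Measure ℝ := volume.restrict (Ioo 0 1)

theorem ae_unitVol_mem : ∀ᵐ u ∂unitVol, u ∈ Ioo (0 : ℝ) 1 := ae_restrict_mem measurableSet_Ioo

instance : IsProbabilityMeasure unitVol := ⟨by simp [unitVol]⟩

/-- Right continuity of the distribution function makes the infimum attained, which yields this
Galois connection; the later facts on quantiles come from it. -/
theorem quantile_le_iff (μ : Measure ℝ) {u : ℝ} (hu : u ∈ Ioo (0 : ℝ) 1) (x : ℝ) :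
    quantile μ u ≤ x ↔ u ≤ cdf μ x := by
  rw [quantile, if_pos hu]
  have hbdd : BddBelow {x | u ≤ cdf μ x} := by
    obtain ⟨m, hm⟩ := ((tendsto_cdf_atBot μ).eventually (gt_mem_nhds hu.1)).exists
    refine ⟨m, fun y hy => ?_⟩
    by_contra! hlt
    exact absurd (le_trans hy (monotone_cdf μ hlt.le)) (not_le.2 hm)
  have hne : {x | u ≤ cdf μ x}.Nonempty := by
    obtain ⟨m, hm⟩ := ((tendsto_cdf_atTop μ).eventually (lt_mem_nhds hu.2)).exists
    exact ⟨m, hm.le⟩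
  refine ⟨fun h => ?_, fun h => csInf_le hbdd h⟩
  have hc : Tendsto (cdf μ) (𝓝[>] x) (𝓝 (cdf μ x)) :=
    ((cdf μ).right_continuous x).tendsto.mono_left (nhdsWithin_mono _ Ioi_subset_Ici_self)
  refine ge_of_tendsto hc ?_
  filter_upwards [self_mem_nhdsWithin] with y hy
  obtain ⟨w, hw, hwy⟩ := exists_lt_of_csInf_lt hne (h.trans_lt hy)
  exact le_trans hw (monotone_cdf μ hwy.le)

theorem measurable_quantile (μ : Measure ℝ) : Measurable (quantile μ) := by
  refine measurable_of_Iic fun x => ?_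
  have : quantile μ ⁻¹' Iic x =
      (Ioo 0 1 ∩ Iic (cdf μ x)) ∪ ((Ioo (0 : ℝ) 1)ᶜ ∩ {_u | (0 : ℝ) ≤ x}) := by
    ext u
    by_cases hu : u ∈ Ioo (0 : ℝ) 1
    · simp only [mem_preimage, mem_Iic, quantile_le_iff μ hu, mem_union, mem_inter_iff, hu,
        mem_compl_iff]
      simp
    · simp only [mem_preimage, mem_Iic, quantile, mem_union, mem_inter_iff, hu,
        mem_compl_iff, mem_ofPred_eq]
      simp
  rw [this]
  exact (measurableSet_Ioo.inter measurableSet_Iic).union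
    (measurableSet_Ioo.compl.inter (.const _))

theorem map_quantile (μ : Measure ℝ) [IsProbabilityMeasure μ] :
    unitVol.map (quantile μ) = μ := by
  have := Measure.isProbabilityMeasure_map (μ := unitVol) (measurable_quantile μ).aemeasurable
  refine Measure.ext_of_Iic _ _ fun x => ?_
  rw [Measure.map_apply (measurable_quantile μ) measurableSet_Iic, unitVol,
    -- The closed right end covers the value 1 of the distribution function.
    Measure.restrict_congr_set Ioo_ae_eq_Ioc,
    measure_congr (t := Iic (cdf μ x)), Measure.restrict_apply measurableSet_Iic, inter_comm,
    Ioc_inter_Iic, Real.volume_Ioc, min_eq_right (cdf_le_one μ x), sub_zero, ofReal_cdf]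
  rw [← Measure.restrict_congr_set Ioo_ae_eq_Ioc]
  filter_upwards [ae_unitVol_mem] with u hu
  exact propext (quantile_le_iff μ hu x)

/-- The monotone plan. -/
def monotonePlan (μ ν : Measure ℝ) : Measure (ℝ × ℝ) :=
  unitVol.map fun u => (quantile μ u, quantile ν u)

/-! ### Plans induced by two functions on a common space. -/

theorem cost_map {Ω : Type*} [MeasurableSpace Ω] (P : Measure Ω) {f g : Ω → ℝ}
    (hf : Measurable f) (hg : Measurable g) :
    cost (P.map fun u => (f u, g u)) = ∫⁻ u, edist (f u) (g u) ∂P :=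
  lintegral_map (by fun_prop) (by fun_prop)

theorem isPlan_map {Ω X : Type*} [MeasurableSpace Ω] [MeasurableSpace X] (P : Measure Ω)
    {f g : Ω → X} (hf : Measurable f) (hg : Measurable g) :
    IsPlan (P.map fun u => (f u, g u)) (P.map f) (P.map g) :=
  ⟨by rw [Measure.map_map (by fun_prop) (by fun_prop)]; rfl,
    by rw [Measure.map_map (by fun_prop) (by fun_prop)]; rfl⟩

theorem W_le_cost {μ ν : Measure ℝ} {τ : Measure (ℝ × ℝ)} (h : IsPlan τ μ ν) :
    W μ ν ≤ cost τ := iInf₂_le τ h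

theorem W_map_le {Ω : Type*} [MeasurableSpace Ω] (P : Measure Ω) {f g : Ω → ℝ}
    (hf : Measurable f) (hg : Measurable g) :
    W (P.map f) (P.map g) ≤ ∫⁻ u, edist (f u) (g u) ∂P :=
  (W_le_cost (isPlan_map P hf hg)).trans (cost_map P hf hg).le

section Line

variable (μ ν : Measure ℝ) [IsProbabilityMeasure μ] [IsProbabilityMeasure ν]

theorem isPlan_monotonePlan : IsPlan (monotonePlan μ ν) μ ν := by
  have h := isPlan_map unitVol (measurable_quantile μ) (measurable_quantile ν)
  rwa [map_quantile, map_quantile] at h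

/-- The level `z` separates the two quantiles of order `u` only if `u` lies between the two values
of the distribution functions at `z`. So the monotone plan attains the lower bound valid for all
plans. -/
theorem cost_monotonePlan_le :
    cost (monotonePlan μ ν) ≤ ∫⁻ z, edist (cdf μ z) (cdf ν z) := by
  have := isFiniteMeasure_of_isPlan (isPlan_monotonePlan μ ν)
  have hm : Measurable fun u => (quantile μ u, quantile ν u) :=
    (measurable_quantile μ).prodMk (measurable_quantile ν)
  rw [cost_eq_lintegral_separated]
  refine lintegral_mono fun z => ?_
  have hz : MeasurableSet (separated z) :=
    measurableSet_separated_uncurry.preimage (f := fun p => (p, z)) (by fun_prop)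
  rw [monotonePlan, Measure.map_apply hm hz]
  calc unitVol ((fun u => (quantile μ u, quantile ν u)) ⁻¹' separated z)
      ≤ unitVol (uIoc (cdf μ z) (cdf ν z)) := by
        refine measure_mono_ae ?_
        filter_upwards [ae_unitVol_mem] with u hu h
        change u ∈ (fun u => (quantile μ u, quantile ν u)) ⁻¹' separated z at h
        change u ∈ uIoc (cdf μ z) (cdf ν z)
        simp only [separated, mem_preimage, mem_ofPred_eq] at h
        have hμ := quantile_le_iff μ hu z
        have hν := quantile_le_iff ν hu z
        rw [mem_uIoc]
        grind
    _ ≤ volume (uIoc (cdf μ z) (cdf ν z)) := Measure.restrict_apply_le _ _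
    _ = edist (cdf μ z) (cdf ν z) := by
        rw [uIoc, Real.volume_Ioc, max_sub_min_eq_abs, edist_dist, Real.dist_eq, abs_sub_comm]

/-- The Wasserstein distance on the line is the `L¹` distance of the distribution functions. -/
theorem W_eq_lintegral_edist_cdf : W μ ν = ∫⁻ z, edist (cdf μ z) (cdf ν z) :=
  le_antisymm ((W_le_cost (isPlan_monotonePlan μ ν)).trans (cost_monotonePlan_le μ ν))
    (le_iInf₂ fun _ h => lintegral_edist_cdf_le_cost h)

theorem isOptPlan_monotonePlan : IsOptPlan (monotonePlan μ ν) μ ν :=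
  ⟨isPlan_monotonePlan μ ν, fun _ h =>
    (cost_monotonePlan_le μ ν).trans (lintegral_edist_cdf_le_cost h)⟩

theorem lintegral_edist_quantile_eq_W :
    ∫⁻ u, edist (quantile μ u) (quantile ν u) ∂unitVol = W μ ν := by
  rw [← cost_map _ (measurable_quantile μ) (measurable_quantile ν)]
  exact le_antisymm ((cost_monotonePlan_le μ ν).trans (W_eq_lintegral_edist_cdf μ ν).ge)
    (W_le_cost (isPlan_monotonePlan μ ν))

theorem W_comm : W μ ν = W ν μ := by
  simp only [W_eq_lintegral_edist_cdf, edist_comm]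

/-- The `L¹` formula replaces the gluing of plans. -/
theorem W_triangle (ρ : Measure ℝ) [IsProbabilityMeasure ρ] : W μ ρ ≤ W μ ν + W ν ρ := by
  simp only [W_eq_lintegral_edist_cdf]
  rw [← lintegral_add_left
    ((monotone_cdf μ).measurable.edist (monotone_cdf ν).measurable)]
  exact lintegral_mono fun z => edist_triangle _ _ _

variable {μ ν} in
theorem eq_of_W_eq_zero (h : W μ ν = 0) : μ = ν := by
  rw [W_eq_lintegral_edist_cdf, lintegral_eq_zero_iff
    ((monotone_cdf μ).measurable.edist (monotone_cdf ν).measurable)] at h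
  refine Measure.eq_of_cdf μ ν (StieltjesFunction.ext fun x => ?_)
  -- By right continuity a difference at `x` would persist on an interval to the right of `x`,
  -- against equality almost everywhere.
  by_contra hne
  have hc : ∀ ρ : Measure ℝ, Tendsto (cdf ρ) (𝓝[>] x) (𝓝 (cdf ρ x)) := fun ρ =>
    ((cdf ρ).right_continuous x).tendsto.mono_left (nhdsWithin_mono _ Ioi_subset_Ici_self)
  have hev := ((hc μ).prodMk_nhds (hc ν)).eventually (isClosed_diagonal.isOpen_compl.mem_nhds hne)
  obtain ⟨y, hy, hsub⟩ := mem_nhdsGT_iff_exists_Ioo_subset.1 hev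
  have h0 : volume (Ioo x y) = 0 := by
    rw [measure_eq_zero_iff_ae_notMem]
    filter_upwards [h] with z hz hzI
    exact hsub hzI (edist_eq_zero.1 hz)
  rw [Real.volume_Ioo, ENNReal.ofReal_eq_zero] at h0
  exact absurd (mem_Ioi.1 hy) (by linarith)

end Line

/-! ### The vector field in terms of quantiles -/

/-- The velocity of the quantile of order `u`. -/
def quantileVel (u : ℝ) : ℝ := if u ≤ 1 / 2 then -1 else 1

theorem measurable_quantileVel : Measurable quantileVel :=
  Measurable.ite measurableSet_Iic measurable_const measurable_const

theorem quantile_mono (μ : Measure ℝ) {u v : ℝ} (hu : u ∈ Ioo (0 : ℝ) 1) (hv : v ∈ Ioo (0 : ℝ) 1)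
    (h : u ≤ v) : quantile μ u ≤ quantile μ v :=
  (quantile_le_iff μ hu _).2 (h.trans ((quantile_le_iff μ hv _).1 le_rfl))

/-- Quantiles are monotone, so orders below and above 1/2 land on either side of `quantile μ (1 /
2)`. This is the leftmost median, whereas `med` is the rightmost; uniqueness of splittings makes the
difference harmless. -/
theorem isSplit_map_quantile (μ : Measure ℝ) :
    IsSplit ((unitVol.restrict (Iic (1 / 2))).map (quantile μ))
      ((unitVol.restrict (Ioi (1 / 2))).map (quantile μ)) (quantile μ (1 / 2)) := by
  have hq := measurable_quantile μ
  refine ⟨?_, ?_, ?_, ?_⟩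
  · rw [Measure.map_apply hq .univ, preimage_univ, Measure.restrict_apply_univ, unitVol,
      Measure.restrict_congr_set Ioo_ae_eq_Ioc, Measure.restrict_apply measurableSet_Iic,
      inter_comm, Ioc_inter_Iic, Real.volume_Ioc]
    norm_num
    rw [one_div, ENNReal.ofReal_inv_of_pos (by norm_num)]
    simp
  · rw [Measure.map_apply hq .univ, preimage_univ, Measure.restrict_apply_univ, unitVol,
      Measure.restrict_apply measurableSet_Ioi, inter_comm, Ioo_inter_Ioi, Real.volume_Ioo]
    norm_num
    rw [one_div, ENNReal.ofReal_inv_of_pos (by norm_num)]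
    simp
  · rw [Measure.map_apply hq measurableSet_Ioi, Measure.restrict_apply (hq measurableSet_Ioi)]
    rw [measure_eq_zero_iff_ae_notMem]
    filter_upwards [ae_unitVol_mem] with u hu h
    exact absurd (quantile_mono μ hu (by norm_num) h.2) (not_le.2 h.1)
  · rw [Measure.map_apply hq measurableSet_Iio, Measure.restrict_apply (hq measurableSet_Iio),
      measure_eq_zero_iff_ae_notMem]
    filter_upwards [ae_unitVol_mem] with u hu h
    exact absurd (quantile_mono μ (by norm_num) hu (le_of_lt h.2)) (not_le.2 h.1)

theorem medianPVF_meas_eq_map_quantile (μ : ProbabilityMeasure ℝ) :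
    medianPVF.meas μ = unitVol.map fun u => (quantile (μ : Measure ℝ) u, quantileVel u) := by
  have hq := measurable_quantile (μ : Measure ℝ)
  have hs := measurable_quantileVel
  have hu : unitVol = unitVol.restrict (Iic (1 / 2)) + unitVol.restrict (Ioi (1 / 2)) := by
    rw [← compl_Iic, Measure.restrict_add_restrict_compl measurableSet_Iic]
  have hμ : (μ : Measure ℝ) = (unitVol.restrict (Iic (1 / 2))).map (quantile (μ : Measure ℝ)) +
      (unitVol.restrict (Ioi (1 / 2))).map (quantile (μ : Measure ℝ)) := by
    rw [← Measure.map_add _ _ hq, ← hu, map_quantile]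
  rw [medianPVF_meas_eq_of_isSplit (isSplit_map_quantile _) μ hμ, hu,
    Measure.map_add _ _ (by fun_prop), ← hu, Measure.map_map (by fun_prop) hq,
    Measure.map_map (by fun_prop) hq]
  congr 1
  · refine Measure.map_congr ?_
    filter_upwards [ae_restrict_mem measurableSet_Iic] with u hu
    exact congrArg (Prod.mk _) (if_pos hu).symm
  · refine Measure.map_congr ?_
    filter_upwards [ae_restrict_mem measurableSet_Ioi] with u hu
    exact congrArg (Prod.mk _) (if_neg (not_le.2 hu)).symm

/-- Couple through the common order `u`: the bases form the monotone plan, which is optimal, and the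
velocities coincide since `quantileVel` does not depend on the measure. -/
theorem fiberW_medianPVF (μ ν : ProbabilityMeasure ℝ) :
    fiberW (medianPVF.meas μ) (medianPVF.meas ν) = 0 := by
  have hμ := measurable_quantile (μ : Measure ℝ)
  have hν := measurable_quantile (ν : Measure ℝ)
  have hs := measurable_quantileVel
  have hT : IsPlan (unitVol.map fun u => ((quantile (μ : Measure ℝ) u, quantileVel u),
      (quantile (ν : Measure ℝ) u, quantileVel u))) (medianPVF.meas μ) (medianPVF.meas ν) := by
    rw [medianPVF_meas_eq_map_quantile, medianPVF_meas_eq_map_quantile]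
    exact isPlan_map unitVol (hμ.prodMk hs) (hν.prodMk hs)
  have hO : IsOptPlan ((unitVol.map fun u => ((quantile (μ : Measure ℝ) u, quantileVel u),
      (quantile (ν : Measure ℝ) u, quantileVel u))).map proj13)
      ((medianPVF.meas μ).map Prod.fst) ((medianPVF.meas ν).map Prod.fst) := by
    have hp : Measurable proj13 := by unfold proj13; fun_prop
    have h := isOptPlan_monotonePlan (μ : Measure ℝ) (ν : Measure ℝ)
    rw [Measure.map_map hp (by fun_prop), PVF.meas, PVF.meas, medianPVF.base, medianPVF.base]
    exact h
  rw [fiberW, ← le_zero_iff]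
  refine iInf_le_of_le _ (iInf_le_of_le hT (iInf_le_of_le hO ?_))
  rw [lintegral_map (by fun_prop) (by fun_prop)]
  simp

/-! ### Stability of the flow -/

theorem flowMeas_eq_map_quantile (μ : Measure ℝ) [IsProbabilityMeasure μ] (t : ℝ) :
    flowMeas μ t = unitVol.map fun u => quantile μ u + t * quantileVel u := by
  obtain ⟨P, rfl⟩ : ∃ P : ProbabilityMeasure ℝ, (P : Measure ℝ) = μ := ⟨⟨μ, inferInstance⟩, rfl⟩
  have hq := measurable_quantile (P : Measure ℝ)
  have hs := measurable_quantileVel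
  rw [flowMeas_eq_map, medianPVF_meas_eq_map_quantile,
    Measure.map_map (by fun_prop) (by fun_prop)]
  rfl

/-- Quantiles of equal order undergo the same displacement, so the monotone coupling keeps its cost.
-/
theorem W_flowMeas_le (μ ν : Measure ℝ) [IsProbabilityMeasure μ] [IsProbabilityMeasure ν] (t : ℝ) :
    W (flowMeas μ t) (flowMeas ν t) ≤ W μ ν := by
  have hμ := measurable_quantile μ
  have hν := measurable_quantile ν
  have hs := measurable_quantileVel
  rw [flowMeas_eq_map_quantile, flowMeas_eq_map_quantile, ← lintegral_edist_quantile_eq_W μ ν]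
  refine (W_map_le _ (by fun_prop) (by fun_prop)).trans (lintegral_mono fun u => ?_)
  rw [edist_add_right]

theorem W_flowMeas_flowMeas_le (μ : Measure ℝ) [IsProbabilityMeasure μ] (t s : ℝ) :
    W (flowMeas μ t) (flowMeas μ s) ≤ ENNReal.ofReal |t - s| := by
  have hμ := measurable_quantile μ
  have hs := measurable_quantileVel
  rw [flowMeas_eq_map_quantile, flowMeas_eq_map_quantile]
  refine (W_map_le _ (by fun_prop) (by fun_prop)).trans ?_
  have h : ∀ u, edist (quantile μ u + t * quantileVel u) (quantile μ u + s * quantileVel u) =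
      ENNReal.ofReal |t - s| := fun u => by
    rw [edist_add_left, edist_dist, Real.dist_eq, ← sub_mul, abs_mul]
    unfold quantileVel
    split_ifs <;> simp
  simp [h]

theorem isLipschitzSemigroup_medianFlow {C : ℝ} (hC : SupportSublinear medianPVF C) (T : ℝ) :
    IsLipschitzSemigroup medianPVF C T medianFlow := by
  have hC1 := one_le_of_supportSublinear hC
  refine ⟨fun μ => Pc.ext_coe (flowMeas_zero _), fun μ t _ s hs _ =>
    Pc.ext_coe (flowMeas_flowMeas _ hs.1 t), fun μ => isSolution_medianFlow T μ,
    fun R hR => ⟨1, one_pos, fun μ ν hμ hν t ht s hs => ⟨?_, ?_, ?_⟩⟩⟩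
  · refine (flowMeas_support_subset _ (hμ.trans Metric.ball_subset_closedBall) t).trans
      (Metric.closedBall_subset_ball ?_)
    rw [abs_of_nonneg ht.1]
    -- Since `C ≥ 1`; then `R + t < (1 + t)(R + 1)`, which puts the closed ball inside the open one.
    have h1 : 1 + t ≤ Real.exp (C * t) := by
      have := Real.add_one_le_exp (C * t)
      nlinarith [ht.1]
    nlinarith [ht.1, mul_nonneg ht.1 hR.le]
  · refine (W_flowMeas_le _ _ t).trans (le_mul_of_one_le_left zero_le ?_)
    rw [ENNReal.one_le_ofReal, one_mul]
    exact Real.one_le_exp ht.1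
  · rw [one_mul]
    exact W_flowMeas_flowMeas_le _ t s

/-! ### Lattice approximate solutions -/

section Grid

variable {N : ℕ}

theorem gridX_injective (hN : 0 < N) : Function.Injective (gridX N) := by
  intro i j h
  have hN' : (0 : ℝ) < (N : ℝ) ^ 2 := by positivity
  rw [gridX, gridX, div_left_inj' hN'.ne'] at h
  exact_mod_cast h

theorem mem_Ico_gridX_iff (hN : 0 < N) (x : ℝ) (i : ℤ) :
    x ∈ Ico (gridX N i) (gridX N i + 1 / (N : ℝ) ^ 2) ↔ ⌊x * (N : ℝ) ^ 2⌋ = i := by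
  have hN' : (0 : ℝ) < (N : ℝ) ^ 2 := by positivity
  rw [Int.floor_eq_iff, mem_Ico, gridX, ← add_div, div_le_iff₀ hN', lt_div_iff₀ hN']

theorem gridV_mem_Ico_gridV_iff (hN : 0 < N) (i j : ℤ) :
    gridV N i ∈ Ico (gridV N j) (gridV N j + 1 / (N : ℝ)) ↔ i = j := by
  have hN' : (0 : ℝ) < (N : ℝ) := by positivity
  rw [mem_Ico, gridV, gridV, ← add_div, div_le_div_iff_of_pos_right hN',
    div_lt_div_iff_of_pos_right hN']
  norm_cast
  omega

theorem mem_idxX_of_abs_le (hN : 0 < N) {i : ℤ} (h : |gridX N i| ≤ N) : i ∈ idxX N := by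
  have hN' : (0 : ℝ) < (N : ℝ) ^ 2 := by positivity
  rw [gridX, abs_div, abs_of_pos hN', div_le_iff₀ hN', abs_le] at h
  rw [idxX, Finset.mem_Icc]
  constructor
  · have : ((-(N : ℤ) ^ 3 : ℤ) : ℝ) ≤ i := by push_cast; linarith [h.1, pow_succ' (N : ℝ) 2]
    exact_mod_cast this
  · have : (i : ℝ) ≤ (((N : ℤ) ^ 3 : ℤ) : ℝ) := by push_cast; linarith [h.2, pow_succ' (N : ℝ) 2]
    exact_mod_cast this

/-- `μ` is carried by the points of the (unbounded) space grid in `[-M, M]`. -/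
def OnGrid (N : ℕ) (M : ℝ) (μ : Measure ℝ) : Prop :=
  ∀ᵐ x ∂μ, x ∈ range (gridX N) ∩ Metric.closedBall 0 M

theorem measurableSet_onGrid (N : ℕ) (M : ℝ) :
    MeasurableSet {x | x ∈ range (gridX N) ∩ Metric.closedBall 0 M} :=
  (countable_range _).measurableSet.inter Metric.isClosed_closedBall.measurableSet

/-- Positions and the velocities ±1 are already nodes of the lattice, so the velocity discretisation
changes nothing. -/
theorem advance_eq_map (hN : 0 < N) {Λ : Measure (ℝ × ℝ)}
    (h : ∀ᵐ p ∂Λ, p.1 ∈ range (gridX N) ∩ Metric.closedBall 0 (N : ℝ) ∧ (p.2 = -1 ∨ p.2 = 1))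
    (s : ℝ) : advance N Λ s = Λ.map (fun p => p.1 + s * p.2) := by
  have hN' : (0 : ℝ) < (N : ℝ) := by positivity
  ext A hA
  have hcell : ∀ i j : ℤ, MeasurableSet
      (({gridX N i} : Set ℝ) ×ˢ Ico (gridV N j) (gridV N j + 1 / (N : ℝ))) := fun i j =>
    (measurableSet_singleton _).prod measurableSet_Ico
  have hg : Measurable fun p : ℝ × ℝ => p.1 + s * p.2 := by fun_prop
  rw [Measure.map_apply hg hA, ← lintegral_indicator_one (hA.preimage hg), advance]
  simp only [Measure.finsetSum_apply, Measure.smul_apply, smul_eq_mul, massV]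
  -- Both sides become integrals against `Λ`; almost every point lies in exactly one cell, so a
  -- single term of the sum survives.
  simp_rw [mul_comm (Λ _), ← lintegral_indicator_const (hcell _ _)]
  simp_rw [← lintegral_finsetSum (idxV N) fun j _ => measurable_const.indicator (hcell _ j)]
  rw [← lintegral_finsetSum (idxX N) fun i _ => Finset.measurable_sum _ fun j _ =>
    measurable_const.indicator (hcell i j)]
  refine lintegral_congr_ae ?_
  filter_upwards [h] with p hp
  obtain ⟨x, v⟩ := p
  obtain ⟨⟨⟨i, rfl⟩, hi⟩, hv⟩ := hp
  rw [mem_closedBall_zero_iff, Real.norm_eq_abs] at hi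
  obtain ⟨j, hj, rfl⟩ : ∃ j ∈ idxV N, v = gridV N j := by
    have hNN : (N : ℤ) ≤ (N : ℤ) ^ 2 := by exact_mod_cast Nat.le_self_pow two_ne_zero N
    rcases hv with hv | hv
    · exact ⟨-N, by rw [idxV, Finset.mem_Icc]; constructor <;> nlinarith,
        by simp only at hv; rw [hv, gridV]; push_cast; field_simp⟩
    · exact ⟨N, by rw [idxV, Finset.mem_Icc]; constructor <;> nlinarith,
        by simp only at hv; rw [hv, gridV]; push_cast; field_simp⟩
  have hmem : ∀ i' j' : ℤ, (gridX N i, gridV N j) ∈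
      ({gridX N i'} : Set ℝ) ×ˢ Ico (gridV N j') (gridV N j' + 1 / (N : ℝ)) ↔ i = i' ∧ j = j' := by
    intro i' j'
    rw [mem_prod, mem_singleton_iff, (gridX_injective hN).eq_iff, gridV_mem_Ico_gridV_iff hN]
  rw [Finset.sum_eq_single_of_mem i (mem_idxX_of_abs_le hN hi), Finset.sum_eq_single_of_mem j hj,
    indicator_of_mem ((hmem i j).2 ⟨rfl, rfl⟩), Measure.dirac_apply' _ hA]
  · rfl
  · exact fun j' _ hne => indicator_of_notMem (fun hm => hne ((hmem i j').1 hm).2.symm) _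
  · exact fun i' _ hne => Finset.sum_eq_zero fun j' _ =>
      indicator_of_notMem (fun hm => hne ((hmem i' j').1 hm).1.symm) _

theorem advance_medianPVF (hN : 0 < N) {μ : Measure ℝ} [IsProbabilityMeasure μ]
    (h : OnGrid N N μ) (s : ℝ) : advance N (medianPVF.ext μ) s = flowMeas μ s := by
  obtain ⟨P, rfl⟩ : ∃ P : ProbabilityMeasure ℝ, (P : Measure ℝ) = μ := ⟨⟨μ, inferInstance⟩, rfl⟩
  have he : medianPVF.ext (P : Measure ℝ) = medianPVF.meas P := dif_pos P.2
  rw [he, flowMeas_eq_map]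
  refine advance_eq_map hN ?_ s
  have hb : (medianPVF.meas P).map Prod.fst = (P : Measure ℝ) := medianPVF.base P
  rw [OnGrid, ← hb] at h
  exact (ae_of_ae_map (by fun_prop) h).and (ae_medianPVF_meas P)

theorem OnGrid.flowMeas {μ : Measure ℝ} [IsProbabilityMeasure μ] {M : ℝ} (hN : 0 < N)
    (h : OnGrid N M μ) (ℓ : ℕ) : OnGrid N (M + ℓ / N) (flowMeas μ (ℓ / N)) := by
  have hN' : (0 : ℝ) < (N : ℝ) := by positivity
  have hm := measurableSet_onGrid N (M + ℓ / N)
  have hℓ : |(ℓ : ℝ) / N| = ℓ / N := abs_of_nonneg (by positivity)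
  rw [OnGrid, ← lowerHalf_add_upperHalf μ, ae_add_measure_iff] at h
  rw [OnGrid, MDE.flowMeas, ae_add_measure_iff, ae_map_iff (by fun_prop) hm,
    ae_map_iff (by fun_prop) hm]
  constructor
  · filter_upwards [h.1] with x hx
    obtain ⟨⟨i, rfl⟩, hi⟩ := hx
    rw [mem_closedBall_zero_iff, Real.norm_eq_abs] at hi
    -- The displacement `ℓ / N` equals `ℓ N` cells of width `1 / N²`.
    refine ⟨⟨i - ℓ * N, ?_⟩, ?_⟩
    · simp only [gridX]; push_cast; field_simp
    · rw [mem_closedBall_zero_iff, Real.norm_eq_abs]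
      exact (abs_sub _ _).trans (by linarith)
  · filter_upwards [h.2] with x hx
    obtain ⟨⟨i, rfl⟩, hi⟩ := hx
    rw [mem_closedBall_zero_iff, Real.norm_eq_abs] at hi
    refine ⟨⟨i + ℓ * N, ?_⟩, ?_⟩
    · simp only [gridX]; push_cast; field_simp
    · rw [mem_closedBall_zero_iff, Real.norm_eq_abs]
      exact (abs_add_le _ _).trans (by linarith)

theorem OnGrid.mono {μ : Measure ℝ} {M M' : ℝ} (h : OnGrid N M μ) (hM : M ≤ M') :
    OnGrid N M' μ := by
  filter_upwards [h] with x hx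
  exact ⟨hx.1, Metric.closedBall_subset_closedBall hM hx.2⟩

/-- The left end of the cell of the space grid that contains `x`. -/
def gridFloor (N : ℕ) (x : ℝ) : ℝ := gridX N ⌊x * (N : ℝ) ^ 2⌋

theorem measurable_gridFloor (N : ℕ) : Measurable (gridFloor N) := by
  have h : Measurable (gridX N) := measurable_from_top
  exact h.comp (Int.measurable_floor.comp (by fun_prop))

theorem abs_gridFloor_sub_le (hN : 0 < N) (x : ℝ) : |gridFloor N x - x| ≤ 1 / (N : ℝ) ^ 2 := by
  obtain ⟨h1, h2⟩ := (mem_Ico_gridX_iff hN x _).2 rfl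
  rw [abs_sub_le_iff, gridFloor]
  constructor
  · have : (0 : ℝ) ≤ 1 / (N : ℝ) ^ 2 := by positivity
    linarith
  · linarith

theorem discX_eq_map (hN : 0 < N) {μ : Measure ℝ} (h : ∀ᵐ x ∂μ, |x| ≤ (N : ℝ)) :
    discX N μ = μ.map (gridFloor N) := by
  have hN' : (0 : ℝ) < (N : ℝ) ^ 2 := by positivity
  ext A hA
  have hcell : ∀ i : ℤ, MeasurableSet (Ico (gridX N i) (gridX N i + 1 / (N : ℝ) ^ 2)) :=
    fun i => measurableSet_Ico
  have hg := measurable_gridFloor N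
  rw [Measure.map_apply hg hA, ← lintegral_indicator_one (hA.preimage hg), discX]
  simp only [Measure.finsetSum_apply, Measure.smul_apply, smul_eq_mul]
  simp_rw [mul_comm (μ _), ← lintegral_indicator_const (hcell _)]
  rw [← lintegral_finsetSum (idxX N) fun i _ => measurable_const.indicator (hcell i)]
  refine lintegral_congr_ae ?_
  filter_upwards [h] with x hx
  have hi : ⌊x * (N : ℝ) ^ 2⌋ ∈ idxX N := by
    rw [abs_le] at hx
    rw [idxX, Finset.mem_Icc]
    constructor
    · rw [Int.le_floor]
      push_cast
      nlinarith
    · rw [← Int.cast_le (R := ℝ)]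
      refine (Int.floor_le _).trans ?_
      push_cast
      nlinarith
  rw [Finset.sum_eq_single_of_mem _ hi, indicator_of_mem ((mem_Ico_gridX_iff hN x _).2 rfl),
    Measure.dirac_apply' _ hA]
  · rfl
  · exact fun i _ hne => indicator_of_notMem
      (fun hm => hne ((mem_Ico_gridX_iff hN x i).1 hm).symm) _

theorem onGrid_map_gridFloor (hN : 0 < N) {μ : Measure ℝ} {R : ℝ} (h : ∀ᵐ x ∂μ, |x| ≤ R) :
    OnGrid N (R + 1) (μ.map (gridFloor N)) := by
  rw [OnGrid, ae_map_iff (measurable_gridFloor N).aemeasurable (measurableSet_onGrid N _)]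
  filter_upwards [h] with x hx
  refine ⟨⟨_, rfl⟩, ?_⟩
  have h1 := abs_gridFloor_sub_le hN x
  have h2 : 1 / (N : ℝ) ^ 2 ≤ 1 := by
    have : (1 : ℝ) ≤ N := by exact_mod_cast hN
    rw [div_le_one (by positivity)]
    nlinarith
  rw [mem_closedBall_zero_iff, Real.norm_eq_abs]
  have h3 := abs_sub_abs_le_abs_sub (gridFloor N x) x
  linarith

theorem W_map_gridFloor_le (hN : 0 < N) (μ : Measure ℝ) [IsProbabilityMeasure μ] :
    W (μ.map (gridFloor N)) μ ≤ ENNReal.ofReal (1 / (N : ℝ) ^ 2) := by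
  have h := W_map_le μ (measurable_gridFloor N) measurable_id
  rw [Measure.map_id] at h
  refine h.trans ((lintegral_mono fun x => ?_).trans
    (by simp : ∫⁻ _, ENNReal.ofReal (1 / (N : ℝ) ^ 2) ∂μ ≤ _))
  rw [edist_dist, Real.dist_eq]
  exact ENNReal.ofReal_le_ofReal (abs_gridFloor_sub_le hN x)

/-- By induction on the step: `R` bounds the datum, 1 the rounding and `T` the displacement, so `R +
1 + T ≤ N` keeps the mass on the bounded grid and each step is exact. -/
theorem lasStep_medianPVF (hN : 0 < N) {μ : Measure ℝ} [IsProbabilityMeasure μ] {R T : ℝ}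
    (h : ∀ᵐ x ∂μ, |x| ≤ R) (hT : 0 ≤ T) (hR : R + 1 + T ≤ N) (ℓ : ℕ) (hℓ : (ℓ : ℝ) / N ≤ T) :
    lasStep medianPVF N μ ℓ = flowMeas (μ.map (gridFloor N)) (ℓ / N) := by
  have := Measure.isProbabilityMeasure_map (μ := μ) (measurable_gridFloor N).aemeasurable
  have hN' : (0 : ℝ) < (N : ℝ) := by positivity
  induction ℓ with
  | zero =>
    rw [lasStep, discX_eq_map hN (h.mono fun x hx => by linarith), Nat.cast_zero, zero_div,
      flowMeas_zero]
  | succ ℓ ih =>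
    have hle : (ℓ : ℝ) / N ≤ T := le_trans (by gcongr; simp) hℓ
    rw [lasStep, ih hle, advance_medianPVF hN
      (((onGrid_map_gridFloor hN h).flowMeas hN ℓ).mono (by linarith)),
      flowMeas_flowMeas _ (by positivity)]
    congr 1
    push_cast
    ring

theorem las_medianPVF (hN : 0 < N) {μ : Measure ℝ} [IsProbabilityMeasure μ] {R T : ℝ}
    (h : ∀ᵐ x ∂μ, |x| ≤ R) (hR : R + 1 + T ≤ N) {t : ℝ} (ht : t ∈ Icc 0 T) :
    las medianPVF N μ t = flowMeas (μ.map (gridFloor N)) t := by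
  have := Measure.isProbabilityMeasure_map (μ := μ) (measurable_gridFloor N).aemeasurable
  have hN' : (0 : ℝ) < (N : ℝ) := by positivity
  have hle : ((⌊t * (N : ℝ)⌋₊ : ℕ) : ℝ) / N ≤ T := by
    rw [div_le_iff₀ hN']
    exact (Nat.floor_le (mul_nonneg ht.1 hN'.le)).trans (by gcongr; exact ht.2)
  rw [las, lasStep_medianPVF hN h (ht.1.trans ht.2) hR _ hle, advance_medianPVF hN
    (((onGrid_map_gridFloor hN h).flowMeas hN _).mono (by linarith)),
    flowMeas_flowMeas _ (by positivity), sub_add_cancel]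

end Grid

/-! ### Convergence of the lattice approximate solutions and uniqueness of their limits. -/

theorem eventually_las_medianPVF (T : ℝ) (μ : Pc) : ∀ᶠ N : ℕ in atTop, ∀ t ∈ Icc 0 T,
    IsProbabilityMeasure (las medianPVF N (μ.1 : Measure ℝ) t) ∧
    W (las medianPVF N (μ.1 : Measure ℝ) t) ((medianFlow t μ).1 : Measure ℝ) ≤
      ENNReal.ofReal (1 / (N : ℝ) ^ 2) := by
  obtain ⟨R, -, hR⟩ := μ.exists_supp_subset
  have hae : ∀ᵐ x ∂(μ.1 : Measure ℝ), |x| ≤ R := by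
    filter_upwards [(support_subset_iff_ae Metric.isClosed_closedBall).1 hR] with x hx
    simpa using hx
  filter_upwards [eventually_gt_atTop 0, tendsto_natCast_atTop_atTop.eventually_ge_atTop
    (R + 1 + T)] with N hN hNR t ht
  have := Measure.isProbabilityMeasure_map (μ := (μ.1 : Measure ℝ))
    (measurable_gridFloor N).aemeasurable
  rw [las_medianPVF hN hae hNR ht]
  exact ⟨inferInstance, (W_flowMeas_le _ _ t).trans (W_map_gridFloor_le hN _)⟩

theorem tendsto_ofReal_one_div_sq :
    Tendsto (fun N : ℕ => ENNReal.ofReal (1 / (N : ℝ) ^ 2)) atTop (𝓝 0) := by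
  have h : Tendsto (fun N : ℕ => (1 / (N : ℝ)) ^ 2) atTop (𝓝 (0 ^ 2)) :=
    tendsto_one_div_atTop_nhds_zero_nat.pow 2
  simp only [div_pow, one_pow, zero_pow two_ne_zero] at h
  simpa using ENNReal.tendsto_ofReal h

theorem lasTendsto_medianFlow (T : ℝ) (μ : Pc) :
    LASTendsto medianPVF T μ (fun N => N) (fun t => medianFlow t μ) := by
  refine tendsto_of_tendsto_of_tendsto_of_le_of_le' tendsto_const_nhds tendsto_ofReal_one_div_sq
    (.of_forall fun _ => zero_le) ?_
  filter_upwards [eventually_las_medianPVF T μ] with N hN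
  exact iSup₂_le fun t ht => (hN t ht).2

/-- At each time the triangle inequality through the approximate solutions makes the distance of the
two limits zero. -/
theorem eq_medianFlow_of_lasTendsto {T : ℝ} {μ : Pc} {φ : ℕ → ℕ} {ρ : ℝ → Pc}
    (hφ : StrictMono φ) (h : LASTendsto medianPVF T μ φ ρ) {t : ℝ} (ht : t ∈ Icc 0 T) :
    ρ t = medianFlow t μ := by
  refine Pc.ext_coe (eq_of_W_eq_zero (le_zero_iff.1 ?_))
  have hlim := h.add (tendsto_ofReal_one_div_sq.comp hφ.tendsto_atTop)
  rw [add_zero] at hlim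
  refine ge_of_tendsto hlim ?_
  filter_upwards [hφ.tendsto_atTop.eventually (eventually_las_medianPVF T μ)] with k hk
  have := (hk t ht).1
  refine (W_triangle _ (las medianPVF (φ k) (μ.1 : Measure ℝ) t) _).trans
    (add_le_add ?_ (hk t ht).2)
  rw [W_comm]
  exact le_iSup₂ (f := fun t (_ : t ∈ Icc (0 : ℝ) T) =>
    W (las medianPVF (φ k) (μ.1 : Measure ℝ) t) ((ρ t).1 : Measure ℝ)) t ht

end MDE

end

theorem proposition6p4 :
    H1 medianPVF ∧
    H3 medianPVF ∧
    (∀ μ ν : Pc, fiberW (medianPVF.meas μ.1) (medianPVF.meas ν.1) = 0) ∧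
    ∀ T : ℝ, 0 < T → ∃ S : ℝ → Pc → Pc,
      -- the lattice approximate solutions converge, and have no other limit,
      -- even along subsequences
      (∀ μ₀ : Pc, LASTendsto medianPVF T μ₀ (fun N => N) (fun t => S t μ₀)) ∧
      (∀ (μ₀ : Pc) (φ : ℕ → ℕ) (ρ : ℝ → Pc), StrictMono φ →
        LASTendsto medianPVF T μ₀ φ ρ → ∀ t ∈ Icc (0 : ℝ) T, ρ t = S t μ₀) ∧
      -- `S` is the unique Lipschitz semigroup whose trajectories are limits of
      -- lattice approximate solutions
      (∀ C : ℝ, 0 < C → SupportSublinear medianPVF C →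
        IsLipschitzSemigroup medianPVF C T S ∧
        ∀ S' : ℝ → Pc → Pc, IsLipschitzSemigroup medianPVF C T S' →
          (∀ μ₀ : Pc, ∃ φ : ℕ → ℕ, StrictMono φ ∧
            LASTendsto medianPVF T μ₀ φ (fun t => S' t μ₀)) →
          ∀ t ∈ Icc (0 : ℝ) T, ∀ μ₀ : Pc, S' t μ₀ = S t μ₀) ∧
      -- the explicit formula
      (∀ μ₀ : Pc, ∀ t ∈ Icc (0 : ℝ) T, ∀ A : Set ℝ, MeasurableSet A →
        ((S t μ₀).1 : Measure ℝ) A =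
          (μ₀.1 : Measure ℝ) ((fun x => x + t) '' (A ∩ Iio (med (μ₀.1 : Measure ℝ) - t))) +
          (μ₀.1 : Measure ℝ) ((fun x => x - t) '' (A ∩ Ioi (med (μ₀.1 : Measure ℝ) + t))) +
          massR (μ₀.1 : Measure ℝ) * Measure.dirac (med (μ₀.1 : Measure ℝ) + t) A +
          massL (μ₀.1 : Measure ℝ) * Measure.dirac (med (μ₀.1 : Measure ℝ) - t) A) ∧
      -- the solution that starts from a Dirac mass
      (∀ (x₀ : ℝ) (μ₀ : Pc), (μ₀.1 : Measure ℝ) = Measure.dirac x₀ → ∀ t ∈ Icc (0 : ℝ) T,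
        ((S t μ₀).1 : Measure ℝ) =
          (1 / 2 : ℝ≥0∞) • Measure.dirac (x₀ + t) + (1 / 2 : ℝ≥0∞) • Measure.dirac (x₀ - t)) ∧
      -- the solution that starts from the uniform probability measure on `[a, b]`
      (∀ (a b : ℝ) (μ₀ : Pc), a < b →
        (μ₀.1 : Measure ℝ) = (ENNReal.ofReal (b - a))⁻¹ • volume.restrict (Icc a b) →
        ∀ t ∈ Icc (0 : ℝ) T,
          ((S t μ₀).1 : Measure ℝ) =
            (ENNReal.ofReal (b - a))⁻¹ • volume.restrict (Icc (a - t) ((a + b) / 2 - t)) +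
            (ENNReal.ofReal (b - a))⁻¹ • volume.restrict (Icc ((a + b) / 2 + t) (b + t))) := by
  refine ⟨⟨1, one_pos, supportSublinear_one⟩,
    fun R _ => ⟨1, one_pos, fun μ ν _ _ => (fiberW_medianPVF μ.1 ν.1).trans_le zero_le⟩,
    fun μ ν => fiberW_medianPVF μ.1 ν.1, fun T _ => ⟨medianFlow, lasTendsto_medianFlow T,
      fun μ₀ φ ρ hφ h t ht => eq_medianFlow_of_lasTendsto hφ h ht,
      fun C _ hC => ⟨isLipschitzSemigroup_medianFlow hC T, fun S' _ h t ht μ₀ => ?_⟩,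
      fun μ₀ t _ A hA => flowMeas_apply _ t hA, fun x₀ μ₀ h t _ => ?_,
      fun a b μ₀ hab h t _ => ?_⟩⟩
  · obtain ⟨φ, hφ, hlim⟩ := h μ₀
    exact eq_medianFlow_of_lasTendsto hφ hlim ht
  · rw [coe_medianFlow, h, flowMeas_dirac]
  · rw [coe_medianFlow, h, flowMeas_uniform hab]
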